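/- Let $\frac13<\alpha<\frac12$, let $a\le b$, and let $\mathbf{x}=(x,\mathbb{X})$ be an $\alpha$-Hölder rough path on $[a,b]$ over $\mathbb{R}^m$: $x:[a,b]\to\mathbb{R}^m$ is $\alpha$-Hölder, $\|\mathbb{X}_{s,t}\|\le K|t-s|^{2\alpha}$ for some constant $K$, and Chen's relation $\mathbb{X}_{s,t}-\mathbb{X}_{s,u}-\mathbb{X}_{u,t}=x_{s,u}\otimes x_{u,t}$ holds for $a\le s\le u\le t\le b$, where $x_{s,t}=x_t-x_s$. Let $A\in\mathbb{R}^{d\times d}$, let $C=(C_1,\dots,C_m)$ with $C_j\in\mathbb{R}^{d\times d}$, and write $(Cy)v=\sum_j v_jC_jy$ for $v\in\mathbb{R}^m$. Let $f:\mathbb{R}^d\to\mathbb{R}^d$ be locally Lipschitz with linear growth, $\|f(y)\|\le K_f(1+\|y\|)$ for some constant $K_f$ (for instance, $f$ globally Lipschitz). A pair $(y,y')$ is controlled by $x$, written $(y,y')\in\mathcal{D}^{2\alpha}_x([a,b])$, if $y$ and $y'$ are $\alpha$-Hölder on $[a,b]$, with $y_t\in\mathbb{R}^d$ and $y'_t\in\mathcal{L}(\mathbb{R}^m,\mathbb{R}^d)$,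 and $\|y_{s,t}-y'_sx_{s,t}\|\le K|t-s|^{2\alpha}$ for all $a\le s\le t\le b$ and some constant $K$. The rough integral of $Cy$, with Gubinelli derivative $Cy'$, is $$\int_s^t Cy_u\,dx_u=\lim_{|\Pi|\to0}\sum_{[u,v]\in\Pi}\bigl[Cy_u\,x_{u,v}+Cy'_u\,\mathbb{X}_{u,v}\bigr],$$ the limit being taken over the finite partitions $\Pi$ of $[s,t]$, where $(Cy'_u)(v\otimes w)=\sum_jw_jC_j(y'_uv)$. **Theorem (existence and uniqueness of the solution, $G(y)=Cy$).** For every $\eta\in\mathbb{R}^d$: 1. (Forward equation.) There is exactly one $(y,y')\in\mathcal{D}^{2\alpha}_x([a,b])$ such that $y_a=\eta$, $y'=Cy$, and for all $t\in[a,b]$ the rough integral below exists and $$y_t=y_a+\int_a^t\bigl[Ay_u+f(y_u)\bigr]du+\int_a^tCy_u\,dx_u .$$ 2. (Backward equation.) There is exactly one $(y,y')\in\mathcal{D}^{2\alpha}_x([a,b])$ such that $y_b=\eta$, $y'=Cy$, and for all $t\in[a,b]$ the rough integral below exists and $$y_t=y_b-\int_t^b\bigl[Ay_u+f(y_u)\bigr]du-\int_t^bCy_u\,dx_u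 .$$ -/

import Mathlib

open scoped NNReal

/-- `x` together with `X` is an `α`-Hölder rough path on `[a, b]` over `ℝᵐ`. The entry `X s t i j`
stands for `∫ₛᵗ (xⁱ_r - xⁱ_s) dxʲ_r`, and `chen` is the relation
`X_{s,t} - X_{s,u} - X_{u,t} = x_{s,u} ⊗ x_{u,t}`. -/
structure IsRoughPath {m : ℕ} (α : ℝ≥0) (a b : ℝ) (x : ℝ → EuclideanSpace ℝ (Fin m))
    (X : ℝ → ℝ → Matrix (Fin m) (Fin m) ℝ) : Prop where
  holder : ∃ K : ℝ≥0, HolderOnWith K α x (Set.Icc a b)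
  holder_two : ∃ K : ℝ, ∀ s t : ℝ, a ≤ s → s ≤ t → t ≤ b → ∀ i j : Fin m,
    |X s t i j| ≤ K * (t - s) ^ (2 * (α : ℝ))
  chen : ∀ s u t : ℝ, a ≤ s → s ≤ u → u ≤ t → t ≤ b → ∀ i j : Fin m,
    X s t i j - X s u i j - X u t i j = (x u i - x s i) * (x t j - x u j)

/-- `(y, y')` is an element of the space `𝒟_x^{2α}([a, b])` of paths controlled by `x`:
`y` and its Gubinelli derivative `y'` are `α`-Hölder, and the remainder
`R_{s,t} = y_t - y_s - y'_s x_{s,t}` is `2α`-Hölder. -/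
structure IsControlled {m : ℕ} {F : Type*} [NormedAddCommGroup F] [NormedSpace ℝ F]
    (α : ℝ≥0) (a b : ℝ) (x : ℝ → EuclideanSpace ℝ (Fin m))
    (y : ℝ → F) (y' : ℝ → EuclideanSpace ℝ (Fin m) →L[ℝ] F) : Prop where
  holder : ∃ K : ℝ≥0, HolderOnWith K α y (Set.Icc a b)
  holder_deriv : ∃ K : ℝ≥0, HolderOnWith K α y' (Set.Icc a b)
  remainder : ∃ K : ℝ, ∀ s t : ℝ, a ≤ s → s ≤ t → t ≤ b →
    ‖y t - y s - y' s (x t - x s)‖ ≤ K * (t - s) ^ (2 * (α : ℝ))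

/-- The action of `B ∈ L(ℝᵐ, L(ℝᵐ, F))` on a matrix `M ∈ ℝᵐ ⊗ ℝᵐ`: linear in `M`, with
`B (v ⊗ w) = (B v) w`. -/
noncomputable def tensorApply {m : ℕ} {F : Type*} [NormedAddCommGroup F] [NormedSpace ℝ F]
    (B : EuclideanSpace ℝ (Fin m) →L[ℝ] EuclideanSpace ℝ (Fin m) →L[ℝ] F)
    (M : Matrix (Fin m) (Fin m) ℝ) : F :=
  ∑ i, ∑ j, M i j • B (EuclideanSpace.single i 1) (EuclideanSpace.single j 1)

/-- `p 0 < p 1 < ⋯ < p n` is a partition of `[s, t]`. -/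
def IsPartition (s t : ℝ) (n : ℕ) (p : ℕ → ℝ) : Prop :=
  p 0 = s ∧ p n = t ∧ ∀ k < n, p k < p (k + 1)

/-- The rough integral `∫ₛᵗ z dx` of the controlled path `(z, z')` exists and equals `I`: the
compensated Riemann sums `∑ (z_u x_{u,v} + z'_u X_{u,v})` over the partitions of `[s, t]` converge
to `I` as the mesh tends to `0`. -/
def HasRoughIntegral {m : ℕ} {F : Type*} [NormedAddCommGroup F] [NormedSpace ℝ F]
    (x : ℝ → EuclideanSpace ℝ (Fin m)) (X : ℝ → ℝ → Matrix (Fin m) (Fin m) ℝ)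
    (z : ℝ → EuclideanSpace ℝ (Fin m) →L[ℝ] F)
    (z' : ℝ → EuclideanSpace ℝ (Fin m) →L[ℝ] EuclideanSpace ℝ (Fin m) →L[ℝ] F)
    (s t : ℝ) (I : F) : Prop :=
  ∀ ε > 0, ∃ δ > 0, ∀ (n : ℕ) (p : ℕ → ℝ), IsPartition s t n p →
    (∀ k < n, p (k + 1) - p k < δ) →
    ‖∑ k ∈ Finset.range n,
        (z (p k) (x (p (k + 1)) - x (p k)) + tensorApply (z' (p k)) (X (p k) (p (k + 1)))) - I‖ < ε

/-- The linear vector fields `G(y) = C y = (C₁ y, …, C_m y)`, as the linear map that sends `y` to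
`v ↦ ∑ⱼ vⱼ Cⱼ y`. -/
noncomputable def linearNoise {m d : ℕ} (C : Fin m → Matrix (Fin d) (Fin d) ℝ) :
    EuclideanSpace ℝ (Fin d) →L[ℝ] EuclideanSpace ℝ (Fin m) →L[ℝ] EuclideanSpace ℝ (Fin d) :=
  ∑ j, (ContinuousLinearMap.smulRightL ℝ (EuclideanSpace ℝ (Fin m)) (EuclideanSpace ℝ (Fin d))
    (EuclideanSpace.proj j)) ∘L (Matrix.toEuclideanCLM (𝕜 := ℝ) (C j))

theorem linearNoise_apply {m d : ℕ} (C : Fin m → Matrix (Fin d) (Fin d) ℝ)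
    (y : EuclideanSpace ℝ (Fin d)) (v : EuclideanSpace ℝ (Fin m)) :
    linearNoise C y v = ∑ j, v j • Matrix.toEuclideanCLM (𝕜 := ℝ) (C j) y := by
  simp [linearNoise]

/-- `(y, y')` solves `dy = (A y + f(y)) dt + C y dx` on `[a, b]`, forward in time from its value
at `a`: it is a controlled path with `y' = C y` and
`y_t = y_a + ∫ₐᵗ (A y_u + f(y_u)) du + ∫ₐᵗ C y_u dx_u`, where the integrand `C y` of the rough
integral has the Gubinelli derivative `C y'`. -/
structure IsForwardSolution {m d : ℕ} (α : ℝ≥0) (a b : ℝ) (x : ℝ → EuclideanSpace ℝ (Fin m))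
    (X : ℝ → ℝ → Matrix (Fin m) (Fin m) ℝ) (A : Matrix (Fin d) (Fin d) ℝ)
    (f : EuclideanSpace ℝ (Fin d) → EuclideanSpace ℝ (Fin d))
    (C : Fin m → Matrix (Fin d) (Fin d) ℝ)
    (y : ℝ → EuclideanSpace ℝ (Fin d))
    (y' : ℝ → EuclideanSpace ℝ (Fin m) →L[ℝ] EuclideanSpace ℝ (Fin d)) : Prop where
  controlled : IsControlled α a b x y y'
  deriv_eq : ∀ t ∈ Set.Icc a b, y' t = linearNoise C (y t)
  equation : ∀ t ∈ Set.Icc a b, ∃ I : EuclideanSpace ℝ (Fin d),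
    HasRoughIntegral x X (fun u => linearNoise C (y u)) (fun u => linearNoise C ∘L y' u) a t I ∧
    y t = y a + (∫ u in a..t, (Matrix.toEuclideanCLM (𝕜 := ℝ) A (y u) + f (y u))) + I

/-- `(y, y')` solves `dy = (A y + f(y)) dt + C y dx` on `[a, b]`, backward in time from its value
at `b`: it is a controlled path with `y' = C y` and
`y_t = y_b - ∫ₜᵇ (A y_u + f(y_u)) du - ∫ₜᵇ C y_u dx_u`. -/
structure IsBackwardSolution {m d : ℕ} (α : ℝ≥0) (a b : ℝ) (x : ℝ → EuclideanSpace ℝ (Fin m))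
    (X : ℝ → ℝ → Matrix (Fin m) (Fin m) ℝ) (A : Matrix (Fin d) (Fin d) ℝ)
    (f : EuclideanSpace ℝ (Fin d) → EuclideanSpace ℝ (Fin d))
    (C : Fin m → Matrix (Fin d) (Fin d) ℝ)
    (y : ℝ → EuclideanSpace ℝ (Fin d))
    (y' : ℝ → EuclideanSpace ℝ (Fin m) →L[ℝ] EuclideanSpace ℝ (Fin d)) : Prop where
  controlled : IsControlled α a b x y y'
  deriv_eq : ∀ t ∈ Set.Icc a b, y' t = linearNoise C (y t)
  equation : ∀ t ∈ Set.Icc a b, ∃ I : EuclideanSpace ℝ (Fin d),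
    HasRoughIntegral x X (fun u => linearNoise C (y u)) (fun u => linearNoise C ∘L y' u) t b I ∧
    y t = y b - (∫ u in t..b, (Matrix.toEuclideanCLM (𝕜 := ℝ) A (y u) + f (y u))) - I

open Filter Topology Set MeasureTheory

/-! Because the noise enters linearly, it can be transformed away (Doss-Sussmann). Write `g y = A y
+ f y`. The driftless equation `dy = C y dx` has a flow of invertible linear maps `φ t` with
inverses `ψ t`; substituting `y = φ v` turns the full equation into the ordinary equation `v' = ψ (g
(φ v))`. Its field is continuous in time, locally Lipschitz and of linear growth, so it has exactly
one solution on the whole interval from a value at either end.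

The flow comes from `exists_multiplicative_family`. By Chen's relation the second order expansion
`flowGerm` is multiplicative up to order `3 α > 1` (`isOrder_flowGerm_mul`), so products of it over
fine grids have multiplicative limits that stay within order `3 α` of it.

The link between rough and ordinary equation is Davie's formulation: `y t - flowGerm s t (y s) - ∫ g
(y)` has order `3 α`. The compensated Riemann summand is exactly `flowGerm s t (y s) - y s`, so
additive sewing and telescoping make this equivalent to the integral equation
(`isForwardSolution_iff`, `isBackwardSolution_iff`). The condition favours neither end point, hence
it serves both equations. Finally `isOrder_defect_sub` compares the Davie defect of `y` with the
defect of `ψ y` in the ordinary equation; they differ by order `3 α` after applying `φ`. -/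

/-! ### Discrete sewing estimates on uniform grids -/

lemma rpow_add_rpow_le_of_le_two_thirds {x y θ : ℝ} (hθ : 1 < θ) (hx : 0 ≤ x) (hy : 0 ≤ y)
    (hxy : x ≤ 2 / 3 * (x + y)) (hyx : y ≤ 2 / 3 * (x + y)) :
    x ^ θ + y ^ θ ≤ (2 / 3 : ℝ) ^ (θ - 1) * (x + y) ^ θ := by
  have key : ∀ z : ℝ, 0 ≤ z → z ^ θ = z ^ (θ - 1) * z := fun z hz ↦ by
    have := Real.rpow_add_of_nonneg hz (show 0 ≤ θ - 1 by linarith) zero_le_one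
    rwa [Real.rpow_one, sub_add_cancel] at this
  have hpow : ∀ z : ℝ, 0 ≤ z → z ≤ 2 / 3 * (x + y) →
      z ^ (θ - 1) ≤ (2 / 3 : ℝ) ^ (θ - 1) * (x + y) ^ (θ - 1) := fun z hz hz' ↦ by
    rw [← Real.mul_rpow (by norm_num) (by linarith)]
    exact Real.rpow_le_rpow hz hz' (by linarith)
  rw [key x hx, key y hy, key (x + y) (by linarith)]
  nlinarith [mul_le_mul_of_nonneg_right (hpow x hx hxy) hx,
    mul_le_mul_of_nonneg_right (hpow y hy hyx) hy]

/-- Halving `n ≥ 2` steps leaves at most two thirds on each side, the worst case being `n = 3`. As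
`θ > 1`, the factor `(2 / 3) ^ (θ - 1)` is less than one; this gain closes the inductions on the
number of grid steps. -/
lemma half_split_rpow_le {θ h : ℝ} (hθ : 1 < θ) (h0 : 0 ≤ h) {n : ℕ} (hn : 2 ≤ n) :
    (((n / 2 : ℕ) : ℝ) * h) ^ θ + (((n - n / 2 : ℕ) : ℝ) * h) ^ θ
      ≤ (2 / 3 : ℝ) ^ (θ - 1) * ((n : ℝ) * h) ^ θ := by
  have e : ((n / 2 : ℕ) : ℝ) + ((n - n / 2 : ℕ) : ℝ) = n := by
    rw [← Nat.cast_add]; congr 1; omega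
  have h1 : 3 * ((n / 2 : ℕ) : ℝ) ≤ 2 * n := by
    exact_mod_cast (by omega : 3 * (n / 2) ≤ 2 * n)
  have h2 : 3 * ((n - n / 2 : ℕ) : ℝ) ≤ 2 * n := by
    exact_mod_cast (by omega : 3 * (n - n / 2) ≤ 2 * n)
  have := rpow_add_rpow_le_of_le_two_thirds (x := ((n / 2 : ℕ) : ℝ) * h)
    (y := ((n - n / 2 : ℕ) : ℝ) * h) hθ (by positivity) (by positivity)
    (by rw [← add_mul, e]; nlinarith) (by rw [← add_mul, e]; nlinarith)
  rwa [← add_mul, e] at this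

/-- The ordered product `m (i + n - 1) * ⋯ * m (i + 1) * m i`. -/
def orderedProd {𝔸 : Type*} [Monoid 𝔸] (m : ℕ → 𝔸) (i : ℕ) : ℕ → 𝔸
  | 0 => 1
  | n + 1 => m (i + n) * orderedProd m i n

lemma orderedProd_add {𝔸 : Type*} [Monoid 𝔸] (m : ℕ → 𝔸) (i n₁ n₂ : ℕ) :
    orderedProd m i (n₁ + n₂) = orderedProd m (i + n₁) n₂ * orderedProd m i n₁ := by
  induction n₂ with
  | zero => simp [orderedProd]
  | succ k ih => rw [← add_assoc, orderedProd, ih, orderedProd, mul_assoc, add_assoc]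

/-- Products over a uniform grid of an almost multiplicative two-parameter family stay close to
the family. -/
theorem norm_orderedProd_sub_le {𝔸 : Type*} [NormedRing 𝔸] {N : ℕ → ℕ → 𝔸} {J : ℕ}
    {h δ θ K K' B : ℝ} (hθ : 1 < θ) (h0 : 0 ≤ h) (hK0' : 0 ≤ K')
    (hK' : K + B * K' * (2 / 3 : ℝ) ^ (θ - 1) ≤ K')
    (hdiag : ∀ i ≤ J, N i i = 1)
    (hB : ∀ i n, i + n ≤ J → n * h ≤ δ → ‖N i (i + n)‖ + K' * (n * h) ^ θ ≤ B)
    (hmul : ∀ i n₁ n₂, i + n₁ + n₂ ≤ J → ((n₁ + n₂ : ℕ) : ℝ) * h ≤ δ →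
      ‖N (i + n₁) (i + n₁ + n₂) * N i (i + n₁) - N i (i + n₁ + n₂)‖
        ≤ K * (((n₁ + n₂ : ℕ) : ℝ) * h) ^ θ) (n : ℕ) :
    ∀ i, i + n ≤ J → n * h ≤ δ →
      ‖orderedProd (fun k ↦ N k (k + 1)) i n - N i (i + n)‖ ≤ K' * (n * h) ^ θ := by
  induction n using Nat.strong_induction_on with
  | _ n ih =>
  intro i hi hn
  have hnn : 0 ≤ K' * (n * h) ^ θ := by positivity
  obtain rfl | rfl | hn2 : n = 0 ∨ n = 1 ∨ 2 ≤ n := by omega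
  · simpa [orderedProd, hdiag i (by omega)] using hnn
  · simpa [orderedProd] using hnn
  have hs := half_split_rpow_le hθ h0 hn2
  obtain ⟨n₁, hn₁⟩ : ∃ n₁, n₁ = n / 2 := ⟨_, rfl⟩
  rw [← hn₁] at hs
  obtain ⟨n₂, rfl⟩ : ∃ n₂, n = n₁ + n₂ := ⟨n - n₁, by omega⟩
  have e2 : n₁ + n₂ - n₁ = n₂ := by omega
  rw [e2] at hs
  have hle : ∀ k ≤ n₁ + n₂, (k : ℝ) * h ≤ δ := fun k hk ↦
    le_trans (mul_le_mul_of_nonneg_right (by exact_mod_cast hk) h0) hn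
  have l1 := hle n₁ (by omega)
  have l2 := hle n₂ (by omega)
  have i1 := ih n₁ (by omega) i (by omega) l1
  have i2 := ih n₂ (by omega) (i + n₁) (by omega) l2
  have b1 := hB i n₁ (by omega) l1
  have b2 := hB (i + n₁) n₂ (by omega) l2
  have m := hmul i n₁ n₂ (by omega) hn
  rw [orderedProd_add, ← add_assoc]
  set P₁ := orderedProd (fun k ↦ N k (k + 1)) i n₁
  set P₂ := orderedProd (fun k ↦ N k (k + 1)) (i + n₁) n₂
  set N₁ := N i (i + n₁)
  set N₂ := N (i + n₁) (i + n₁ + n₂)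
  set x := ((n₁ : ℝ) * h) ^ θ
  set y := ((n₂ : ℝ) * h) ^ θ
  set z := (((n₁ + n₂ : ℕ) : ℝ) * h) ^ θ
  have hx : 0 ≤ x := by positivity
  have hy : 0 ≤ y := by positivity
  -- `hB` leaves room for the sewing error, so `B` bounds the product as well as the germ.
  have hP₂ : ‖P₂‖ ≤ B := by
    have := norm_le_norm_add_norm_sub' P₂ N₂
    linarith
  have hN₁ : ‖N₁‖ ≤ B := by nlinarith
  have hB0 : 0 ≤ B := (norm_nonneg _).trans hN₁
  have e : P₂ * P₁ - N i (i + n₁ + n₂)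
      = P₂ * (P₁ - N₁) + (P₂ - N₂) * N₁ + (N₂ * N₁ - N i (i + n₁ + n₂)) := by noncomm_ring
  calc _ ≤ ‖P₂‖ * ‖P₁ - N₁‖ + ‖P₂ - N₂‖ * ‖N₁‖ + K * z := by
        rw [e]
        exact (norm_add₃_le).trans (add_le_add (add_le_add (norm_mul_le _ _) (norm_mul_le _ _)) m)
    _ ≤ B * (K' * x) + K' * y * B + K * z := by gcongr
    _ = B * K' * (x + y) + K * z := by ring
    _ ≤ B * K' * ((2 / 3 : ℝ) ^ (θ - 1) * z) + K * z := by gcongr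
    _ = (K + B * K' * (2 / 3 : ℝ) ^ (θ - 1)) * z := by ring
    _ ≤ K' * z := by gcongr

/-- Riemann sums over a uniform grid of an almost additive two-parameter family stay close to the
family. -/
theorem norm_sum_sub_le_of_almost_additive {F : Type*} [SeminormedAddCommGroup F]
    {N : ℕ → ℕ → F} {J : ℕ} {h θ K K' : ℝ} (hθ : 1 < θ) (h0 : 0 ≤ h) (hK0' : 0 ≤ K')
    (hK' : K + K' * (2 / 3 : ℝ) ^ (θ - 1) ≤ K')
    (hdiag : ∀ i ≤ J, N i i = 0)
    (hadd : ∀ i n₁ n₂, i + n₁ + n₂ ≤ J →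
      ‖N (i + n₁) (i + n₁ + n₂) + N i (i + n₁) - N i (i + n₁ + n₂)‖
        ≤ K * (((n₁ + n₂ : ℕ) : ℝ) * h) ^ θ) (n : ℕ) :
    ∀ i, i + n ≤ J →
      ‖∑ k ∈ Finset.range n, N (i + k) (i + k + 1) - N i (i + n)‖ ≤ K' * (n * h) ^ θ := by
  induction n using Nat.strong_induction_on with
  | _ n ih =>
  intro i hi
  have hnn : 0 ≤ K' * (n * h) ^ θ := by positivity
  obtain rfl | rfl | hn2 : n = 0 ∨ n = 1 ∨ 2 ≤ n := by omega
  · simpa [hdiag i (by omega)] using hnn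
  · simpa using hnn
  have hs := half_split_rpow_le hθ h0 hn2
  obtain ⟨n₁, hn₁⟩ : ∃ n₁, n₁ = n / 2 := ⟨_, rfl⟩
  rw [← hn₁] at hs
  obtain ⟨n₂, rfl⟩ : ∃ n₂, n = n₁ + n₂ := ⟨n - n₁, by omega⟩
  have e2 : n₁ + n₂ - n₁ = n₂ := by omega
  rw [e2] at hs
  have i1 := ih n₁ (by omega) i (by omega)
  have i2 := ih n₂ (by omega) (i + n₁) (by omega)
  have m := hadd i n₁ n₂ (by omega)
  rw [Finset.sum_range_add]
  simp only [← add_assoc]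
  set P₁ := ∑ k ∈ Finset.range n₁, N (i + k) (i + k + 1)
  set P₂ := ∑ k ∈ Finset.range n₂, N (i + n₁ + k) (i + n₁ + k + 1)
  set N₁ := N i (i + n₁)
  set N₂ := N (i + n₁) (i + n₁ + n₂)
  set x := ((n₁ : ℝ) * h) ^ θ
  set y := ((n₂ : ℝ) * h) ^ θ
  set z := (((n₁ + n₂ : ℕ) : ℝ) * h) ^ θ
  have e : P₁ + P₂ - N i (i + n₁ + n₂)
      = (P₁ - N₁) + (P₂ - N₂) + (N₂ + N₁ - N i (i + n₁ + n₂)) := by abel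
  calc _ ≤ K' * x + K' * y + K * z := by
        rw [e]
        exact (norm_add₃_le).trans (add_le_add (add_le_add i1 i2) m)
    _ = K' * (x + y) + K * z := by ring
    _ ≤ K' * ((2 / 3 : ℝ) ^ (θ - 1) * z) + K * z := by gcongr
    _ = (K + K' * (2 / 3 : ℝ) ^ (θ - 1)) * z := by ring
    _ ≤ K' * z := by gcongr

/-! ### Multiplicative sewing -/

/-- The sewing estimate controls products only over short stretches. A long product is cut into `k`
short blocks, which gives a bound independent of the mesh once `k` is. -/
lemma norm_orderedProd_le_pow {𝔸 : Type*} [NormedRing 𝔸] {m : ℕ → 𝔸} {J q : ℕ} {B : ℝ}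
    (hone : ‖(1 : 𝔸)‖ ≤ 1) (hB0 : 0 ≤ B)
    (hB : ∀ i n, i + n ≤ J → n ≤ q → ‖orderedProd m i n‖ ≤ B) (k : ℕ) :
    ∀ i n, i + n ≤ J → n ≤ k * q → ‖orderedProd m i n‖ ≤ B ^ k := by
  induction k with
  | zero =>
    intro i n _ hn
    obtain rfl : n = 0 := by omega
    simpa [orderedProd] using hone
  | succ k ih =>
    intro i n hi hn
    rw [add_mul, one_mul] at hn
    obtain ⟨n₁, n₂, rfl, h1, h2⟩ : ∃ n₁ n₂, n = n₁ + n₂ ∧ n₁ ≤ k * q ∧ n₂ ≤ q :=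
      ⟨min n (k * q), n - min n (k * q), by omega, by omega, by omega⟩
    rw [orderedProd_add, pow_succ']
    exact (norm_mul_le _ _).trans (mul_le_mul (hB _ _ (by omega) h2) (ih _ _ (by omega) h1)
      (norm_nonneg _) hB0)

/-- **Multiplicative sewing**: an almost multiplicative two-parameter family in a proper normed
ring is close to a multiplicative one. -/
theorem exists_multiplicative_family {𝔸 : Type*} [NormedRing 𝔸] [ProperSpace 𝔸]
    {a b θ β K₁ K : ℝ} {M : ℝ → ℝ → 𝔸} (hone : ‖(1 : 𝔸)‖ ≤ 1) (hθ : 1 < θ) (hβ : 0 < β)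
    (hcont : ContinuousOn (fun p : ℝ × ℝ ↦ M p.1 p.2) {p | a ≤ p.1 ∧ p.1 ≤ p.2 ∧ p.2 ≤ b})
    (hdiag : ∀ s, a ≤ s → s ≤ b → M s s = 1)
    (hM : ∀ s t, a ≤ s → s ≤ t → t ≤ b → ‖M s t - 1‖ ≤ K₁ * (t - s) ^ β)
    (hmul : ∀ s u t, a ≤ s → s ≤ u → u ≤ t → t ≤ b →
      ‖M u t * M s u - M s t‖ ≤ K * (t - s) ^ θ) :
    ∃ Φ : ℝ → ℝ → 𝔸, (∀ s u t, a ≤ s → s ≤ u → u ≤ t → t ≤ b → Φ u t * Φ s u = Φ s t) ∧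
      ∃ K' : ℝ, ∀ s t, a ≤ s → s ≤ t → t ≤ b → ‖Φ s t - M s t‖ ≤ K' * (t - s) ^ θ := by
  wlog hK₁ : 0 ≤ K₁ generalizing K₁
  · exact this (K₁ := 0) (fun s t h1 h2 h3 ↦ (hM s t h1 h2 h3).trans
      (mul_le_mul_of_nonneg_right (by linarith) (Real.rpow_nonneg (by linarith) _))) le_rfl
  wlog hK : 0 ≤ K generalizing K
  · exact this (K := 0) (fun s u t h1 h2 h3 h4 ↦ (hmul s u t h1 h2 h3 h4).trans
      (mul_le_mul_of_nonneg_right (by linarith) (Real.rpow_nonneg (by linarith) _))) le_rfl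
  obtain ⟨c, hc⟩ : ∃ c : ℝ, c = (2 / 3 : ℝ) ^ (θ - 1) := ⟨_, rfl⟩
  have hc0 : 0 < c := by rw [hc]; positivity
  have hc1 : c < 1 := by
    rw [hc]; exact Real.rpow_lt_one (by norm_num) (by norm_num) (by linarith)
  -- This `B` exceeds `1` while `B * c = (1 + c) / 2` stays below `1`. The next constant `K'` then
  -- solves `K + B * K' * c = K'` exactly.
  obtain ⟨B, hBdef⟩ : ∃ B : ℝ, B = (1 + c) / (2 * c) := ⟨_, rfl⟩
  have hBc : B * c = (1 + c) / 2 := by rw [hBdef]; field_simp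
  have hB1 : 1 < B := by rw [hBdef, lt_div_iff₀ (by positivity)]; linarith
  obtain ⟨K', hK'def⟩ : ∃ K' : ℝ, K' = 2 * K / (1 - c) := ⟨_, rfl⟩
  have h1c : 0 < 1 - c := by linarith
  have hK'0 : 0 ≤ K' := by rw [hK'def]; positivity
  have hK' : K + B * K' * c ≤ K' := by
    have : K' * (1 - c) = 2 * K := by rw [hK'def]; field_simp
    nlinarith
  -- On lengths up to `δ` the germ is so near `1` that its norm plus the sewing error stays below
  -- `B`.
  obtain ⟨δ, hδ0, hδ⟩ : ∃ δ : ℝ, 0 < δ ∧ 1 + K₁ * δ ^ β + K' * δ ^ θ < B := by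
    have ht : Tendsto (fun r : ℝ ↦ 1 + K₁ * r ^ β + K' * r ^ θ) (𝓝[>] 0) (𝓝 1) := by
      have h1 : ContinuousAt (fun r : ℝ ↦ 1 + K₁ * r ^ β + K' * r ^ θ) 0 := by
        have := Real.continuousAt_rpow_const 0 β (Or.inr hβ.le)
        have := Real.continuousAt_rpow_const 0 θ (Or.inr (by linarith))
        fun_prop
      have := h1.tendsto
      rw [Real.zero_rpow hβ.ne', Real.zero_rpow (by linarith)] at this
      simp only [mul_zero, add_zero] at this
      exact this.mono_left nhdsWithin_le_nhds
    obtain ⟨δ, h1, h2⟩ := ((ht.eventually (gt_mem_nhds hB1)).and self_mem_nhdsWithin).exists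
    exact ⟨δ, h2, h1⟩
  have grid : ∀ h : ℝ, 0 < h → ∀ i n : ℕ, a + ((i + n : ℕ) : ℝ) * h ≤ b → n * h ≤ δ →
      ‖orderedProd (fun k : ℕ ↦ M (a + k * h) (a + (k + 1 : ℕ) * h)) i n
        - M (a + i * h) (a + (i + n : ℕ) * h)‖ ≤ K' * (n * h) ^ θ ∧
      ‖orderedProd (fun k : ℕ ↦ M (a + k * h) (a + (k + 1 : ℕ) * h)) i n‖ ≤ B := by
    intro h hh i n hin hn
    have hle : ∀ j k : ℕ, j ≤ k → a + (j : ℝ) * h ≤ a + k * h := fun j k hjk ↦ by gcongr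
    have hge : ∀ j : ℕ, a ≤ a + (j : ℝ) * h := fun j ↦ by
      have : 0 ≤ (j : ℝ) * h := by positivity
      linarith
    have hlen : ∀ j k : ℕ, a + ((j + k : ℕ) : ℝ) * h - (a + j * h) = k * h := fun j k ↦ by
      push_cast; ring
    have hB : ∀ j k, j + k ≤ i + n → k * h ≤ δ →
        ‖M (a + j * h) (a + (j + k : ℕ) * h)‖ + K' * (k * h) ^ θ ≤ B := by
      intro j k hjk hk
      have h1 := hM (a + j * h) (a + (j + k : ℕ) * h) (hge j) (hle _ _ (by omega))
        ((hle _ _ hjk).trans hin)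
      rw [hlen] at h1
      have h2 := norm_le_norm_add_norm_sub' (M (a + j * h) (a + (j + k : ℕ) * h)) 1
      have h3 : K₁ * (k * h) ^ β ≤ K₁ * δ ^ β := by gcongr
      have h4 : K' * (k * h) ^ θ ≤ K' * δ ^ θ := by gcongr
      linarith
    have main := norm_orderedProd_sub_le (N := fun i j ↦ M (a + i * h) (a + j * h)) (J := i + n)
      (δ := δ) (K := K) (B := B) hθ hh.le hK'0 (by rw [← hc]; exact hK')
      (fun j hj ↦ hdiag _ (hge j) ((hle _ _ hj).trans hin)) hB
      (fun j n₁ n₂ hj _ ↦ by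
        have := hmul (a + j * h) (a + (j + n₁ : ℕ) * h) (a + (j + n₁ + n₂ : ℕ) * h) (hge j)
          (hle _ _ (by omega)) (hle _ _ (by omega)) ((hle _ _ hj).trans hin)
        rw [add_assoc j, hlen] at this
        simpa only [add_assoc] using this) n i le_rfl hn
    refine ⟨main, ?_⟩
    have h1 := hB i n le_rfl hn
    have h2 := norm_le_norm_add_norm_sub'
      (orderedProd (fun k : ℕ ↦ M (a + k * h) (a + (k + 1 : ℕ) * h)) i n)
      (M (a + i * h) (a + (i + n : ℕ) * h))
    linarith
  -- For mesh `h ≤ δ / 2`, a block of `⌊δ / h⌋₊` steps has length at least `δ / 2`, so `2 (b - a) /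
  -- δ` blocks cover the interval whatever the mesh.
  obtain ⟨k₀, hk₀⟩ : ∃ k₀ : ℕ, 2 * (b - a) / δ ≤ k₀ := ⟨_, Nat.le_ceil _⟩
  have bdd : ∀ h : ℝ, 0 < h → h ≤ δ / 2 → ∀ i n : ℕ, a + ((i + n : ℕ) : ℝ) * h ≤ b →
      ‖orderedProd (fun k : ℕ ↦ M (a + k * h) (a + (k + 1 : ℕ) * h)) i n‖ ≤ B ^ k₀ := by
    intro h hh hhδ i n hin
    have hq : (⌊δ / h⌋₊ : ℝ) ≤ δ / h := Nat.floor_le (by positivity)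
    have hq' := Nat.lt_floor_add_one (δ / h)
    rw [le_div_iff₀ hh] at hq
    rw [div_lt_iff₀ hh] at hq'
    refine norm_orderedProd_le_pow (J := i + n) (q := ⌊δ / h⌋₊) hone (by linarith)
      (fun j k hjk hk ↦ (grid h hh j k (le_trans ?_ hin) (le_trans ?_ hq)).2) k₀ i n le_rfl ?_
    · gcongr
    · gcongr
    · have h1 : (n : ℝ) * h ≤ b - a := by
        have : 0 ≤ (i : ℝ) * h := by positivity
        push_cast at hin; nlinarith
      have h2 : δ ≤ 2 * (⌊δ / h⌋₊ * h) := by nlinarith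
      rw [div_le_iff₀ hδ0] at hk₀
      have h3 : (k₀ : ℝ) * δ ≤ k₀ * (2 * (⌊δ / h⌋₊ * h)) := by gcongr
      have h4 : (n : ℝ) * h ≤ (k₀ * ⌊δ / h⌋₊ : ℕ) * h := by push_cast; nlinarith
      exact_mod_cast le_of_mul_le_mul_right h4 hh
  let η : ℕ → ℝ := fun n ↦ 1 / ((n : ℝ) + 1)
  have hη0 : ∀ n, 0 < η n := fun n ↦ by positivity
  have hη : Tendsto η atTop (𝓝 0) := tendsto_one_div_add_atTop_nhds_zero_nat
  let idx : ℕ → ℝ → ℕ := fun n s ↦ ⌊(s - a) / η n⌋₊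
  let pt : ℕ → ℝ → ℝ := fun n s ↦ a + idx n s * η n
  have idx_mono : ∀ n s t, s ≤ t → idx n s ≤ idx n t := fun n s t hst ↦
    Nat.floor_mono (div_le_div_of_nonneg_right (by linarith) (hη0 n).le)
  have pt_le : ∀ n s, a ≤ s → pt n s ≤ s := fun n s hs ↦ by
    have : (⌊(s - a) / η n⌋₊ : ℝ) ≤ (s - a) / η n :=
      Nat.floor_le (div_nonneg (by linarith) (hη0 n).le)
    rw [le_div_iff₀ (hη0 n)] at this
    simp only [pt, idx]; linarith
  have le_pt : ∀ n s, a ≤ pt n s := fun n s ↦ by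
    have : 0 ≤ (idx n s : ℝ) * η n := mul_nonneg (Nat.cast_nonneg _) (hη0 n).le
    simp only [pt]; linarith
  have pt_mono : ∀ n s t, s ≤ t → pt n s ≤ pt n t := fun n s t hst ↦ by
    have : (idx n s : ℝ) * η n ≤ idx n t * η n :=
      mul_le_mul_of_nonneg_right (by exact_mod_cast idx_mono n s t hst) (hη0 n).le
    simp only [pt]; linarith
  have pt_gt : ∀ n s, s - η n ≤ pt n s := fun n s ↦ by
    have := Nat.lt_floor_add_one ((s - a) / η n)
    rw [div_lt_iff₀ (hη0 n)] at this
    simp only [pt, idx]; linarith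
  have pt_tendsto : ∀ s, a ≤ s → Tendsto (fun n ↦ pt n s) atTop (𝓝 s) := fun s hs ↦ by
    refine tendsto_of_tendsto_of_tendsto_of_le_of_le (g := fun n ↦ s - η n) (h := fun _ ↦ s) ?_
      tendsto_const_nhds (fun n ↦ pt_gt n s) (fun n ↦ pt_le n s hs)
    simpa using tendsto_const_nhds.sub hη
  let Q : ℝ → ℝ → ℕ → 𝔸 := fun s t n ↦
    orderedProd (fun k : ℕ ↦ M (a + k * η n) (a + (k + 1 : ℕ) * η n)) (idx n s)
      (idx n t - idx n s)
  have Q_bdd : ∀ s t, a ≤ s → s ≤ t → t ≤ b →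
      ∀ᶠ n in atTop, Q s t n ∈ Metric.closedBall 0 (B ^ k₀) := by
    intro s t hs hst ht
    filter_upwards [hη.eventually (ge_mem_nhds (half_pos hδ0))] with n hn
    rw [mem_closedBall_zero_iff]
    refine bdd _ (hη0 n) hn _ _ ?_
    rw [Nat.add_sub_cancel' (idx_mono n s t hst)]
    exact (pt_le n t (hs.trans hst)).trans ht
  -- Convergence of the grid products need not be proved: they are bounded in a proper space, so
  -- they converge along an ultrafilter. One ultrafilter serves all pairs `s, t`, hence the limits
  -- inherit the multiplicativity that holds exactly on each grid.
  let U : Ultrafilter ℕ := hyperfilter ℕ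
  have hU : (U : Filter ℕ) ≤ atTop := Nat.hyperfilter_le_atTop
  have lim : ∀ s t, ∃ L : 𝔸, a ≤ s → s ≤ t → t ≤ b → Tendsto (Q s t) U (𝓝 L) := by
    intro s t
    by_cases h : a ≤ s ∧ s ≤ t ∧ t ≤ b
    · obtain ⟨L, -, hL⟩ := (isCompact_closedBall (0 : 𝔸) (B ^ k₀)).ultrafilter_le_nhds
        (U.map (Q s t)) (le_principal_iff.2 (hU (Q_bdd s t h.1 h.2.1 h.2.2)))
      exact ⟨L, fun _ _ _ ↦ hL⟩
    · exact ⟨0, fun h1 h2 h3 ↦ absurd ⟨h1, h2, h3⟩ h⟩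
  choose Φ hΦ using lim
  have Φ_mem : ∀ s t, a ≤ s → s ≤ t → t ≤ b → ‖Φ s t‖ ≤ B ^ k₀ := fun s t hs hst ht ↦
    mem_closedBall_zero_iff.1 (Metric.isClosed_closedBall.mem_of_tendsto (hΦ s t hs hst ht)
      (hU (Q_bdd s t hs hst ht)))
  refine ⟨Φ, fun s u t hs hsu hut ht ↦ ?_, ?_⟩
  · refine tendsto_nhds_unique (((hΦ u t (hs.trans hsu) hut ht).mul
      (hΦ s u hs hsu (hut.trans ht))).congr fun n ↦ ?_) (hΦ s t hs (hsu.trans hut) ht)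
    have h1 := idx_mono n s u hsu
    have h2 := idx_mono n u t hut
    simp only [Q]
    rw [show idx n t - idx n s = (idx n u - idx n s) + (idx n t - idx n u) by omega,
      orderedProd_add, Nat.add_sub_cancel' h1]
  -- On short intervals the grid estimate passes to the limit, by continuity of `M` at the points
  -- rounded down to the grid.
  · have near : ∀ s t, a ≤ s → s ≤ t → t ≤ b → t - s < δ → ‖Φ s t - M s t‖ ≤ K' * (t - s) ^ θ := by
      intro s t hs hst ht hδst
      have hpt : Tendsto (fun n ↦ (pt n s, pt n t)) atTop
          (𝓝[{p : ℝ × ℝ | a ≤ p.1 ∧ p.1 ≤ p.2 ∧ p.2 ≤ b}] (s, t)) :=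
        tendsto_nhdsWithin_iff.2 ⟨(pt_tendsto s hs).prodMk_nhds (pt_tendsto t (hs.trans hst)),
          Eventually.of_forall fun n ↦
            ⟨le_pt n s, pt_mono n s t hst, (pt_le n t (hs.trans hst)).trans ht⟩⟩
      have hMlim : Tendsto (fun n ↦ M (pt n s) (pt n t)) atTop (𝓝 (M s t)) :=
        (hcont (s, t) ⟨hs, hst, ht⟩).tendsto.comp hpt
      have hlen : Tendsto (fun n ↦ pt n t - pt n s) atTop (𝓝 (t - s)) :=
        (pt_tendsto t (hs.trans hst)).sub (pt_tendsto s hs)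
      have hpow : Tendsto (fun n ↦ K' * (pt n t - pt n s) ^ θ) atTop (𝓝 (K' * (t - s) ^ θ)) :=
        (hlen.rpow_const (Or.inr (by linarith))).const_mul K'
      refine le_of_tendsto_of_tendsto ((hΦ s t hs hst ht).sub (hMlim.mono_left hU)).norm
        (hpow.mono_left hU) (hU ?_)
      filter_upwards [hlen.eventually (ge_mem_nhds hδst)] with n hn
      have e : idx n s + (idx n t - idx n s) = idx n t :=
        Nat.add_sub_cancel' (idx_mono n s t hst)
      have e' : ((idx n t - idx n s : ℕ) : ℝ) * η n = pt n t - pt n s := by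
        rw [Nat.cast_sub (idx_mono n s t hst)]; simp only [pt]; ring
      have := (grid (η n) (hη0 n) (idx n s) (idx n t - idx n s)
        (by rw [e]; exact (pt_le n t (hs.trans hst)).trans ht) (by rw [e']; exact hn)).1
      rwa [e, e'] at this
    -- When `t - s ≥ δ` both families are bounded, and dividing that bound by `δ ^ θ` gives an
    -- admissible constant.
    obtain ⟨D, hD⟩ : ∃ D : ℝ, D = B ^ k₀ + (1 + K₁ * (b - a) ^ β) := ⟨_, rfl⟩
    refine ⟨K' + |D| / δ ^ θ, fun s t hs hst ht ↦ ?_⟩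
    have hr : 0 ≤ (t - s) ^ θ := Real.rpow_nonneg (by linarith) _
    rcases lt_or_ge (t - s) δ with h | h
    · refine (near s t hs hst ht h).trans (mul_le_mul_of_nonneg_right ?_ hr)
      have : 0 ≤ |D| / δ ^ θ := by positivity
      linarith
    · have h1 : ‖M s t‖ ≤ 1 + K₁ * (b - a) ^ β := by
        have h2 := hM s t hs hst ht
        have h3 := norm_le_norm_add_norm_sub' (M s t) 1
        have h4 : K₁ * (t - s) ^ β ≤ K₁ * (b - a) ^ β := by gcongr
        linarith
      have h2 : ‖Φ s t - M s t‖ ≤ |D| := by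
        have := norm_sub_le (Φ s t) (M s t)
        have := Φ_mem s t hs hst ht
        exact le_trans (by linarith) (le_abs_self D)
      have h3 : δ ^ θ ≤ (t - s) ^ θ := by gcongr
      have h4 : |D| ≤ |D| / δ ^ θ * (t - s) ^ θ := by
        rw [div_mul_eq_mul_div, le_div_iff₀ (by positivity)]; gcongr
      have h5 : 0 ≤ K' * (t - s) ^ θ := by positivity
      linarith

/-! ### Limits over partitions and additive sewing -/

/-- The sums of `Ξ` over the partitions of `[s, t]` converge to `I` as the mesh tends to `0`. -/
def HasPartitionLimit {F : Type*} [NormedAddCommGroup F] (Ξ : ℝ → ℝ → F) (s t : ℝ) (I : F) : Prop :=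
  ∀ ε > 0, ∃ δ > 0, ∀ (n : ℕ) (p : ℕ → ℝ), IsPartition s t n p →
    (∀ k < n, p (k + 1) - p k < δ) →
    ‖∑ k ∈ Finset.range n, Ξ (p k) (p (k + 1)) - I‖ < ε

lemma IsPartition.exists_concat {r s t : ℝ} {n m : ℕ} {p q : ℕ → ℝ} (hp : IsPartition r s n p)
    (hq : IsPartition s t m q) {δ : ℝ} (hpδ : ∀ k < n, p (k + 1) - p k < δ)
    (hqδ : ∀ k < m, q (k + 1) - q k < δ) :
    ∃ c : ℕ → ℝ, IsPartition r t (n + m) c ∧ (∀ k < n + m, c (k + 1) - c k < δ) ∧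
      ∀ {F : Type*} [AddCommMonoid F] (Ξ : ℝ → ℝ → F),
        ∑ k ∈ Finset.range (n + m), Ξ (c k) (c (k + 1))
          = ∑ k ∈ Finset.range n, Ξ (p k) (p (k + 1))
            + ∑ k ∈ Finset.range m, Ξ (q k) (q (k + 1)) := by
  obtain ⟨c, hc⟩ : ∃ c : ℕ → ℝ, c = fun k ↦ if k < n then p k else q (k - n) := ⟨_, rfl⟩
  have hl : ∀ k ≤ n, c k = p k := fun k hk ↦ by
    rcases hk.lt_or_eq with h | rfl
    · simp [hc, h]
    · simp [hc, hp.2.1, hq.1]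
  have hr : ∀ k, c (n + k) = q k := fun k ↦ by simp [hc]
  -- Any relation between consecutive points passes to the concatenation; it is used for both
  -- monotonicity and the mesh bound.
  have step : ∀ P : ℝ → ℝ → Prop, (∀ k < n, P (p k) (p (k + 1))) →
      (∀ k < m, P (q k) (q (k + 1))) → ∀ k < n + m, P (c k) (c (k + 1)) := by
    intro P h1 h2 k hk
    by_cases h : k < n
    · rw [hl k h.le, hl (k + 1) h]; exact h1 k h
    · obtain ⟨j, rfl⟩ := Nat.exists_eq_add_of_le (not_lt.1 h)
      rw [hr, add_assoc, hr]; exact h2 j (by omega)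
  refine ⟨c, ⟨?_, ?_, step _ hp.2.2 hq.2.2⟩, step (fun u v ↦ v - u < δ) hpδ hqδ, ?_⟩
  · rw [hl 0 (Nat.zero_le _), hp.1]
  · rw [hr, hq.2.1]
  · intro F _ Ξ
    rw [Finset.sum_range_add]
    congr 1
    · refine Finset.sum_congr rfl fun k hk ↦ ?_
      have := Finset.mem_range.1 hk
      rw [hl k this.le, hl (k + 1) this]
    · refine Finset.sum_congr rfl fun k _ ↦ ?_
      rw [hr, add_assoc, hr]

lemma isPartition_uniform {s t : ℝ} (hst : s < t) {n : ℕ} (hn : 0 < n) :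
    IsPartition s t n (fun k ↦ s + k * ((t - s) / n)) := by
  have hn' : (0 : ℝ) < n := by exact_mod_cast hn
  have h0 : 0 < (t - s) / n := div_pos (by linarith) hn'
  refine ⟨by simp, by field_simp; ring, fun k _ ↦ ?_⟩
  push_cast
  linarith

lemma exists_isPartition_mesh_lt {s t δ : ℝ} (hst : s ≤ t) (hδ : 0 < δ) :
    ∃ (n : ℕ) (p : ℕ → ℝ), IsPartition s t n p ∧ ∀ k < n, p (k + 1) - p k < δ := by
  rcases hst.eq_or_lt with rfl | hst
  · exact ⟨0, fun _ ↦ s, ⟨rfl, rfl, by simp⟩, by simp⟩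
  obtain ⟨n, hn⟩ := exists_nat_gt ((t - s) / δ)
  have hn0 : (0 : ℝ) < n := lt_trans (div_pos (by linarith) hδ) hn
  refine ⟨n, _, isPartition_uniform hst (by exact_mod_cast hn0), fun k _ ↦ ?_⟩
  rw [div_lt_iff₀ hδ] at hn
  have : (t - s) / n < δ := by rw [div_lt_iff₀ hn0]; linarith
  push_cast
  linarith

/-- Every partition of `[s, t]` extends to one of `[r, t]` by prepending a fine partition of `[r,
s]`. The limit on `[s, t]` is thus obtained, not assumed: the forward equation supplies only
integrals starting at `a`. -/
lemma HasPartitionLimit.sub_left {F : Type*} [NormedAddCommGroup F] {Ξ : ℝ → ℝ → F} {r s t : ℝ}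
    {I J : F} (hrs : r ≤ s) (hI : HasPartitionLimit Ξ r s I) (hJ : HasPartitionLimit Ξ r t J) :
    HasPartitionLimit Ξ s t (J - I) := by
  intro ε hε
  obtain ⟨δ₁, h1, hI⟩ := hI (ε / 2) (half_pos hε)
  obtain ⟨δ₂, h2, hJ⟩ := hJ (ε / 2) (half_pos hε)
  refine ⟨min δ₁ δ₂, lt_min h1 h2, fun m q hq hqδ ↦ ?_⟩
  obtain ⟨n, p, hp, hpδ⟩ := exists_isPartition_mesh_lt hrs (lt_min h1 h2)
  obtain ⟨c, hc, hcδ, hsum⟩ := hp.exists_concat hq hpδ hqδ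
  have e1 := hI n p hp fun k hk ↦ (hpδ k hk).trans_le (min_le_left _ _)
  have e2 := hJ _ c hc fun k hk ↦ (hcδ k hk).trans_le (min_le_right _ _)
  rw [hsum] at e2
  have := norm_sub_le (∑ k ∈ Finset.range n, Ξ (p k) (p (k + 1))
    + ∑ k ∈ Finset.range m, Ξ (q k) (q (k + 1)) - J) (∑ k ∈ Finset.range n, Ξ (p k) (p (k + 1)) - I)
  rw [show ∀ A B : F, A + B - J - (A - I) = B - (J - I) from fun A B ↦ by abel] at this
  linarith

/-- The mirror image, appending a partition; the backward equation supplies only integrals ending at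
`b`. -/
lemma HasPartitionLimit.sub_right {F : Type*} [NormedAddCommGroup F] {Ξ : ℝ → ℝ → F} {s t r : ℝ}
    {I J : F} (htr : t ≤ r) (hI : HasPartitionLimit Ξ t r I) (hJ : HasPartitionLimit Ξ s r J) :
    HasPartitionLimit Ξ s t (J - I) := by
  intro ε hε
  obtain ⟨δ₁, h1, hI⟩ := hI (ε / 2) (half_pos hε)
  obtain ⟨δ₂, h2, hJ⟩ := hJ (ε / 2) (half_pos hε)
  refine ⟨min δ₁ δ₂, lt_min h1 h2, fun m q hq hqδ ↦ ?_⟩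
  obtain ⟨n, p, hp, hpδ⟩ := exists_isPartition_mesh_lt htr (lt_min h1 h2)
  obtain ⟨c, hc, hcδ, hsum⟩ := hq.exists_concat hp hqδ hpδ
  have e1 := hI n p hp fun k hk ↦ (hpδ k hk).trans_le (min_le_left _ _)
  have e2 := hJ _ c hc fun k hk ↦ (hcδ k hk).trans_le (min_le_right _ _)
  rw [hsum] at e2
  have := norm_sub_le (∑ k ∈ Finset.range m, Ξ (q k) (q (k + 1))
    + ∑ k ∈ Finset.range n, Ξ (p k) (p (k + 1)) - J) (∑ k ∈ Finset.range n, Ξ (p k) (p (k + 1)) - I)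
  rw [show ∀ A B : F, B + A - J - (A - I) = B - (J - I) from fun A B ↦ by abel] at this
  linarith

/-- The limit of the Riemann sums of an almost additive germ stays close to the germ. -/
theorem exists_norm_partitionLimit_sub_le {F : Type*} [NormedAddCommGroup F] {Ξ : ℝ → ℝ → F}
    {a b θ K : ℝ} (hθ : 1 < θ) (hdiag : ∀ s, a ≤ s → s ≤ b → Ξ s s = 0)
    (hadd : ∀ s u t, a ≤ s → s ≤ u → u ≤ t → t ≤ b →
      ‖Ξ u t + Ξ s u - Ξ s t‖ ≤ K * (t - s) ^ θ) :
    ∃ K' : ℝ, ∀ s t I, a ≤ s → s ≤ t → t ≤ b → HasPartitionLimit Ξ s t I →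
      ‖I - Ξ s t‖ ≤ K' * (t - s) ^ θ := by
  wlog hK : 0 ≤ K generalizing K
  · exact this (K := 0) (fun s u t h1 h2 h3 h4 ↦ (hadd s u t h1 h2 h3 h4).trans
      (mul_le_mul_of_nonneg_right (by linarith) (Real.rpow_nonneg (by linarith) _))) le_rfl
  obtain ⟨c, hc⟩ : ∃ c : ℝ, c = (2 / 3 : ℝ) ^ (θ - 1) := ⟨_, rfl⟩
  have hc1 : 0 < 1 - c := by
    rw [hc]; exact sub_pos.2 (Real.rpow_lt_one (by norm_num) (by norm_num) (by linarith))
  refine ⟨K / (1 - c), fun s t I hs hst ht hI ↦ ?_⟩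
  have hK' : K + K / (1 - c) * c ≤ K / (1 - c) := by
    have : K / (1 - c) * (1 - c) = K := by field_simp
    linarith
  refine le_of_forall_pos_le_add fun ε hε ↦ ?_
  obtain ⟨δ, hδ, hI⟩ := hI ε hε
  -- Since the limit is given to exist, one fine partition suffices, and a uniform grid allows the
  -- discrete estimate. The constant `K / (1 - c)` is the fixed point of `K' = K + K' * c`.
  suffices H : ∃ (n : ℕ) (p : ℕ → ℝ), IsPartition s t n p ∧ (∀ k < n, p (k + 1) - p k < δ) ∧
      ‖∑ k ∈ Finset.range n, Ξ (p k) (p (k + 1)) - Ξ s t‖ ≤ K / (1 - c) * (t - s) ^ θ by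
    obtain ⟨n, p, hp, hpδ, hle⟩ := H
    have h1 := hI n p hp hpδ
    have h2 := norm_sub_le (∑ k ∈ Finset.range n, Ξ (p k) (p (k + 1)) - Ξ s t)
      (∑ k ∈ Finset.range n, Ξ (p k) (p (k + 1)) - I)
    rw [sub_sub_sub_cancel_left] at h2
    linarith
  rcases hst.eq_or_lt with rfl | hlt
  · exact ⟨0, fun _ ↦ s, ⟨rfl, rfl, by simp⟩, by simp, by
      simp [hdiag s hs ht, Real.zero_rpow (by linarith : θ ≠ 0)]⟩
  obtain ⟨n, hn⟩ := exists_nat_gt ((t - s) / δ)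
  have hn0 : (0 : ℝ) < n := lt_trans (div_pos (by linarith) hδ) hn
  have hp := isPartition_uniform hlt (n := n) (by exact_mod_cast hn0)
  obtain ⟨h, hh⟩ : ∃ h : ℝ, h = (t - s) / n := ⟨_, rfl⟩
  have hh0 : 0 < h := by rw [hh]; exact div_pos (by linarith) hn0
  have hnh : n * h = t - s := by rw [hh]; field_simp
  rw [← hh] at hp
  refine ⟨n, _, hp, fun k _ ↦ ?_, ?_⟩
  · rw [div_lt_iff₀ hδ] at hn
    have : h < δ := by rw [hh, div_lt_iff₀ hn0]; linarith
    push_cast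
    linarith
  have hle : ∀ j k : ℕ, j ≤ k → s + (j : ℝ) * h ≤ s + k * h := fun j k hjk ↦ by gcongr
  have hge : ∀ j : ℕ, s ≤ s + (j : ℝ) * h := fun j ↦ by
    have : 0 ≤ (j : ℝ) * h := by positivity
    linarith
  have hend : ∀ j ≤ n, s + (j : ℝ) * h ≤ b := fun j hj ↦ by
    have := hle j n hj
    linarith
  have main := norm_sum_sub_le_of_almost_additive (N := fun i j ↦ Ξ (s + i * h) (s + j * h))
    (J := n) (K := K) (K' := K / (1 - c)) hθ hh0.le (by positivity) (by rw [← hc]; exact hK')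
    (fun j hj ↦ hdiag _ (hs.trans (hge j)) (hend j hj))
    (fun i n₁ n₂ hi ↦ by
      have := hadd (s + i * h) (s + (i + n₁ : ℕ) * h) (s + (i + n₁ + n₂ : ℕ) * h)
        (hs.trans (hge i)) (hle _ _ (by omega)) (hle _ _ (by omega)) (hend _ hi)
      rwa [show s + ((i + n₁ + n₂ : ℕ) : ℝ) * h - (s + i * h) = ((n₁ + n₂ : ℕ) : ℝ) * h by
        push_cast; ring] at this) n 0 (by omega)
  simp only [zero_add, Nat.cast_zero, zero_mul, add_zero, hnh, add_sub_cancel] at main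
  exact main

/-- If the increments of `w` agree with `Ξ` up to an error of order `θ > 1`, the Riemann sums of
`Ξ` converge to the increments of `w`. -/
theorem hasPartitionLimit_of_norm_sub_le {F : Type*} [NormedAddCommGroup F] {Ξ : ℝ → ℝ → F}
    {w : ℝ → F} {s t θ K : ℝ} (hθ : 1 < θ)
    (hw : ∀ u v, s ≤ u → u ≤ v → v ≤ t → ‖w v - w u - Ξ u v‖ ≤ K * (v - u) ^ θ) :
    HasPartitionLimit Ξ s t (w t - w s) := by
  wlog hK : 0 ≤ K generalizing K
  · exact this (K := 0) (fun s t h1 h2 h3 ↦ (hw s t h1 h2 h3).trans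
      (mul_le_mul_of_nonneg_right (by linarith) (Real.rpow_nonneg (by linarith) _))) le_rfl
  intro ε hε
  have ht : Tendsto (fun δ : ℝ ↦ K * δ ^ (θ - 1) * (t - s)) (𝓝[>] 0) (𝓝 0) := by
    have h1 : ContinuousAt (fun δ : ℝ ↦ K * δ ^ (θ - 1) * (t - s)) 0 := by
      have := Real.continuousAt_rpow_const 0 (θ - 1) (Or.inr (by linarith))
      fun_prop
    have := h1.tendsto
    rw [Real.zero_rpow (by linarith), mul_zero, zero_mul] at this
    exact this.mono_left nhdsWithin_le_nhds
  obtain ⟨δ, hδ, hδ0⟩ := ((ht.eventually (gt_mem_nhds hε)).and self_mem_nhdsWithin).exists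
  refine ⟨δ, hδ0, fun n p hp hpδ ↦ lt_of_le_of_lt ?_ hδ⟩
  have hmono : ∀ j k, j ≤ k → k ≤ n → p j ≤ p k := by
    intro j k hjk
    induction k, hjk using Nat.le_induction with
    | base => exact fun _ ↦ le_rfl
    | succ k _ ih => exact fun hk ↦ (ih (by omega)).trans (hp.2.2 k (by omega)).le
  have tele : w t - w s = ∑ k ∈ Finset.range n, (w (p (k + 1)) - w (p k)) := by
    rw [Finset.sum_range_sub (fun k ↦ w (p k)), hp.1, hp.2.1]
  have tele' : t - s = ∑ k ∈ Finset.range n, (p (k + 1) - p k) := by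
    rw [Finset.sum_range_sub, hp.1, hp.2.1]
  rw [norm_sub_rev, tele, ← Finset.sum_sub_distrib, tele', Finset.mul_sum]
  refine norm_sum_le_of_le _ fun k hk ↦ ?_
  have hk := Finset.mem_range.1 hk
  have h0 : 0 ≤ p (k + 1) - p k := sub_nonneg.2 (hp.2.2 k hk).le
  refine (hw (p k) (p (k + 1)) (by rw [← hp.1]; exact hmono 0 k (by omega) (by omega))
    (hp.2.2 k hk).le (by rw [← hp.2.1]; exact hmono _ _ hk le_rfl)).trans ?_
  -- Splitting off one power leaves a factor at most `δ ^ (θ - 1)`; the remaining first powers sum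
  -- to `t - s`.
  have e : (p (k + 1) - p k) ^ θ = (p (k + 1) - p k) ^ (θ - 1) * (p (k + 1) - p k) := by
    have := Real.rpow_add_of_nonneg h0 (show 0 ≤ θ - 1 by linarith) zero_le_one
    rwa [Real.rpow_one, sub_add_cancel] at this
  rw [e, ← mul_assoc]
  have : (p (k + 1) - p k) ^ (θ - 1) ≤ δ ^ (θ - 1) :=
    Real.rpow_le_rpow h0 (hpδ k hk).le (by linarith)
  gcongr

/-! ### Calculus of orders of magnitude -/

/-- `e s u t` is of order `(t - s) ^ p`, uniformly in `a ≤ s ≤ u ≤ t ≤ b`. -/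
def IsOrder {F : Type*} [NormedAddCommGroup F] (a b p : ℝ) (e : ℝ → ℝ → ℝ → F) : Prop :=
  ∃ K : ℝ, ∀ s u t : ℝ, a ≤ s → s ≤ u → u ≤ t → t ≤ b → ‖e s u t‖ ≤ K * (t - s) ^ p

namespace IsOrder

variable {F G H : Type*} [NormedAddCommGroup F] [NormedAddCommGroup G] [NormedAddCommGroup H]
  {a b p q : ℝ} {e e₁ e₂ : ℝ → ℝ → ℝ → F}

lemma exists_nonneg (h : IsOrder a b p e) : ∃ K : ℝ, 0 ≤ K ∧
    ∀ s u t : ℝ, a ≤ s → s ≤ u → u ≤ t → t ≤ b → ‖e s u t‖ ≤ K * (t - s) ^ p := by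
  obtain ⟨K, hK⟩ := h
  exact ⟨|K|, abs_nonneg K, fun s u t h1 h2 h3 h4 ↦ (hK s u t h1 h2 h3 h4).trans
    (mul_le_mul_of_nonneg_right (le_abs_self K) (Real.rpow_nonneg (by linarith) _))⟩

lemma congr (h : IsOrder a b p e₁)
    (he : ∀ s u t : ℝ, a ≤ s → s ≤ u → u ≤ t → t ≤ b → e₂ s u t = e₁ s u t) :
    IsOrder a b p e₂ := by
  obtain ⟨K, hK⟩ := h
  exact ⟨K, fun s u t h1 h2 h3 h4 ↦ by rw [he s u t h1 h2 h3 h4]; exact hK s u t h1 h2 h3 h4⟩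

lemma add (h₁ : IsOrder a b p e₁) (h₂ : IsOrder a b p e₂) :
    IsOrder a b p (fun s u t ↦ e₁ s u t + e₂ s u t) := by
  obtain ⟨K₁, h₁⟩ := h₁
  obtain ⟨K₂, h₂⟩ := h₂
  refine ⟨K₁ + K₂, fun s u t h1 h2 h3 h4 ↦ ?_⟩
  rw [add_mul]
  exact norm_add_le_of_le (h₁ s u t h1 h2 h3 h4) (h₂ s u t h1 h2 h3 h4)

lemma neg (h : IsOrder a b p e) : IsOrder a b p (fun s u t ↦ -e s u t) := by
  simpa only [IsOrder, norm_neg] using h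

lemma sub (h₁ : IsOrder a b p e₁) (h₂ : IsOrder a b p e₂) :
    IsOrder a b p (fun s u t ↦ e₁ s u t - e₂ s u t) := by
  simpa only [sub_eq_add_neg] using h₁.add h₂.neg

lemma mono (h : IsOrder a b p e) (hq : 0 ≤ q) (hqp : q ≤ p) : IsOrder a b q e := by
  obtain ⟨K, hK0, hK⟩ := h.exists_nonneg
  refine ⟨K * (b - a) ^ (p - q), fun s u t h1 h2 h3 h4 ↦ (hK s u t h1 h2 h3 h4).trans ?_⟩
  have e : (t - s) ^ p = (t - s) ^ (p - q) * (t - s) ^ q := by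
    rw [← Real.rpow_add_of_nonneg (by linarith) (by linarith) hq, sub_add_cancel]
  have : (t - s) ^ (p - q) ≤ (b - a) ^ (p - q) :=
    Real.rpow_le_rpow (by linarith) (by linarith) (by linarith)
  rw [e, mul_assoc]
  have : 0 ≤ (t - s) ^ q := Real.rpow_nonneg (by linarith) _
  gcongr

/-- Orders add under any bounded pairing. The norm inequality as hypothesis covers operator
application, ring products and tensor contraction at once. -/
lemma of_norm_le_mul {e₁ : ℝ → ℝ → ℝ → F} {e₂ : ℝ → ℝ → ℝ → G} {e : ℝ → ℝ → ℝ → H}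
    (h₁ : IsOrder a b p e₁) (h₂ : IsOrder a b q e₂) (hp : 0 ≤ p) (hq : 0 ≤ q)
    (he : ∀ s u t : ℝ, a ≤ s → s ≤ u → u ≤ t → t ≤ b →
      ‖e s u t‖ ≤ ‖e₁ s u t‖ * ‖e₂ s u t‖) : IsOrder a b (p + q) e := by
  obtain ⟨K₁, h₁0, h₁⟩ := h₁.exists_nonneg
  obtain ⟨K₂, h₂0, h₂⟩ := h₂.exists_nonneg
  refine ⟨K₁ * K₂, fun s u t h1 h2 h3 h4 ↦ (he s u t h1 h2 h3 h4).trans ?_⟩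
  have := mul_le_mul (h₁ s u t h1 h2 h3 h4) (h₂ s u t h1 h2 h3 h4) (norm_nonneg _)
    (mul_nonneg h₁0 (Real.rpow_nonneg (by linarith) _))
  rw [Real.rpow_add_of_nonneg (by linarith) hp hq]
  linarith

lemma mul {𝔸 : Type*} [NormedRing 𝔸] {e₁ e₂ : ℝ → ℝ → ℝ → 𝔸}
    (h₁ : IsOrder a b p e₁) (h₂ : IsOrder a b q e₂) (hp : 0 ≤ p) (hq : 0 ≤ q) :
    IsOrder a b (p + q) (fun s u t ↦ e₁ s u t * e₂ s u t) :=
  of_norm_le_mul h₁ h₂ hp hq fun _ _ _ _ _ _ _ ↦ norm_mul_le _ _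

lemma of_norm_le {e₁ : ℝ → ℝ → ℝ → F} {e : ℝ → ℝ → ℝ → H} (h₁ : IsOrder a b p e₁) (c : ℝ)
    (he : ∀ s u t : ℝ, a ≤ s → s ≤ u → u ≤ t → t ≤ b → ‖e s u t‖ ≤ c * ‖e₁ s u t‖) :
    IsOrder a b p e := by
  obtain ⟨K₁, h₁0, h₁⟩ := h₁.exists_nonneg
  refine ⟨|c| * K₁, fun s u t h1 h2 h3 h4 ↦ (he s u t h1 h2 h3 h4).trans ?_⟩
  rw [mul_assoc]
  exact mul_le_mul (le_abs_self c) (h₁ s u t h1 h2 h3 h4) (norm_nonneg _) (abs_nonneg c)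

lemma comp_left {e : ℝ → ℝ → F} (h : IsOrder a b p (fun s _ t ↦ e s t)) (hp : 0 ≤ p) :
    IsOrder a b p (fun s u _ ↦ e s u) := by
  obtain ⟨K, hK0, hK⟩ := h.exists_nonneg
  refine ⟨K, fun s u t h1 h2 h3 h4 ↦ (hK s u u h1 h2 le_rfl (h3.trans h4)).trans ?_⟩
  have : (u - s) ^ p ≤ (t - s) ^ p := Real.rpow_le_rpow (by linarith) (by linarith) hp
  gcongr

lemma comp_right {e : ℝ → ℝ → F} (h : IsOrder a b p (fun s _ t ↦ e s t)) (hp : 0 ≤ p) :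
    IsOrder a b p (fun _ u t ↦ e u t) := by
  obtain ⟨K, hK0, hK⟩ := h.exists_nonneg
  refine ⟨K, fun s u t h1 h2 h3 h4 ↦ (hK u u t (h1.trans h2) le_rfl h3 h4).trans ?_⟩
  have : (t - u) ^ p ≤ (t - s) ^ p := Real.rpow_le_rpow (by linarith) (by linarith) hp
  gcongr

lemma of_bounded {C : ℝ}
    (h : ∀ s u t : ℝ, a ≤ s → s ≤ u → u ≤ t → t ≤ b → ‖e s u t‖ ≤ C) : IsOrder a b 0 e :=
  ⟨C, fun s u t h1 h2 h3 h4 ↦ by simpa using h s u t h1 h2 h3 h4⟩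

lemma of_continuousOn_left {y : ℝ → F} (hy : ContinuousOn y (Icc a b)) :
    IsOrder a b 0 (fun s _ _ ↦ y s) := by
  obtain ⟨C, hC⟩ := isCompact_Icc.exists_bound_of_continuousOn hy
  exact of_bounded fun s u t h1 h2 h3 h4 ↦ hC s ⟨h1, by linarith⟩

lemma of_continuousOn_right {y : ℝ → F} (hy : ContinuousOn y (Icc a b)) :
    IsOrder a b 0 (fun _ _ t ↦ y t) := by
  obtain ⟨C, hC⟩ := isCompact_Icc.exists_bound_of_continuousOn hy
  exact of_bounded fun s u t h1 h2 h3 h4 ↦ hC t ⟨by linarith, h4⟩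

/-- The middle variable is the integration variable, and the length of the interval contributes the
extra order. The integrand may still depend on both end points. -/
lemma integral [NormedSpace ℝ F] (h : IsOrder a b p e) :
    IsOrder a b (p + 1) (fun s _ t ↦ ∫ u in s..t, e s u t) := by
  obtain ⟨K, hK0, hK⟩ := h.exists_nonneg
  refine ⟨K, fun s u t h1 h2 h3 h4 ↦ ?_⟩
  have hst : s ≤ t := h2.trans h3
  have := intervalIntegral.norm_integral_le_of_norm_le_const (a := s) (b := t)
    (f := fun u ↦ e s u t) (C := K * (t - s) ^ p) fun r hr ↦ by
      rw [uIoc_of_le hst] at hr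
      exact hK s r t h1 hr.1.le hr.2 h4
  rw [abs_of_nonneg (by linarith)] at this
  rcases hst.eq_or_lt with rfl | hlt
  · simp only [intervalIntegral.integral_same, norm_zero]
    exact mul_nonneg hK0 (Real.rpow_nonneg (by linarith) _)
  · rwa [Real.rpow_add (by linarith), Real.rpow_one, ← mul_assoc]

lemma of_holderOnWith {y : ℝ → F} {K α : ℝ≥0} (hy : HolderOnWith K α y (Icc a b)) :
    IsOrder a b α (fun s _ t ↦ y t - y s) := by
  refine ⟨K, fun s u t h1 h2 h3 h4 ↦ ?_⟩
  have := hy.dist_le (x := t) (y := s) ⟨by linarith, h4⟩ ⟨h1, by linarith⟩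
  rwa [dist_eq_norm, Real.dist_eq, abs_of_nonneg (by linarith)] at this

lemma exists_holderOnWith {y : ℝ → F} {α : ℝ≥0} (hy : IsOrder a b α (fun s _ t ↦ y t - y s)) :
    ∃ K : ℝ≥0, HolderOnWith K α y (Icc a b) := by
  obtain ⟨K, hK0, hK⟩ := hy.exists_nonneg
  have key : ∀ s ∈ Icc a b, ∀ t ∈ Icc a b, s ≤ t →
      edist (y s) (y t) ≤ (K.toNNReal : ENNReal) * edist s t ^ (α : ℝ) := by
    intro s hs t ht hst
    rw [edist_comm, edist_comm s, edist_dist, edist_dist, dist_eq_norm, Real.dist_eq,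
      abs_of_nonneg (by linarith), ENNReal.ofReal_rpow_of_nonneg (sub_nonneg.2 hst) α.coe_nonneg,
      ← ENNReal.ofReal_coe_nnreal, Real.coe_toNNReal _ hK0, ← ENNReal.ofReal_mul hK0]
    exact ENNReal.ofReal_le_ofReal (hK s s t hs.1 le_rfl hst ht.2)
  refine ⟨K.toNNReal, fun s hs t ht ↦ ?_⟩
  rcases le_total s t with h | h
  · exact key s hs t ht h
  · rw [edist_comm, edist_comm s]; exact key t ht s hs h

lemma continuousOn {y : ℝ → F} (hp : 0 < p) (hy : IsOrder a b p (fun s _ t ↦ y t - y s)) :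
    ContinuousOn y (Icc a b) := by
  obtain ⟨K, hK⟩ := exists_holderOnWith (α := ⟨p, hp.le⟩) hy
  exact hK.continuousOn hp

end IsOrder

/-! ### Estimates for rough and controlled paths -/

section TensorApply

variable {m : ℕ} {F : Type*} [NormedAddCommGroup F] [NormedSpace ℝ F]
  (B B' : EuclideanSpace ℝ (Fin m) →L[ℝ] EuclideanSpace ℝ (Fin m) →L[ℝ] F)

lemma tensorApply_sub_left (M : Matrix (Fin m) (Fin m) ℝ) :
    tensorApply (B - B') M = tensorApply B M - tensorApply B' M := by
  simp [tensorApply, smul_sub, Finset.sum_sub_distrib]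

lemma tensorApply_sub (M N : Matrix (Fin m) (Fin m) ℝ) :
    tensorApply B (M - N) = tensorApply B M - tensorApply B N := by
  simp [tensorApply, sub_smul, Finset.sum_sub_distrib]

lemma tensorApply_zero : tensorApply B 0 = 0 := by
  simp [tensorApply]

lemma tensorApply_vecMulVec (v w : EuclideanSpace ℝ (Fin m)) :
    tensorApply B (Matrix.vecMulVec v.ofLp w.ofLp) = B v w := by
  have hv : ∀ v : EuclideanSpace ℝ (Fin m), v = ∑ i, v i • EuclideanSpace.single i (1 : ℝ) := by
    intro v
    ext j
    simp [Finset.sum_apply, Pi.single_apply]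
  conv_rhs => rw [hv v, hv w]
  simp only [tensorApply, Matrix.vecMulVec_apply, map_sum, map_smul,
    sum_apply, smul_apply, Finset.smul_sum, smul_smul]
  rw [Finset.sum_comm]
  simp only [mul_comm]

lemma norm_tensorApply_le (M : Matrix (Fin m) (Fin m) ℝ) :
    ‖tensorApply B M‖ ≤ ‖B‖ * ‖∑ i, ∑ j, |M i j|‖ := by
  refine le_trans ?_ (mul_le_mul_of_nonneg_left (le_abs_self _) (norm_nonneg B))
  rw [tensorApply, Finset.mul_sum]
  refine norm_sum_le_of_le _ fun i _ ↦ ?_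
  rw [Finset.mul_sum]
  refine norm_sum_le_of_le _ fun j _ ↦ ?_
  rw [norm_smul, Real.norm_eq_abs, mul_comm]
  refine mul_le_mul_of_nonneg_right ?_ (abs_nonneg _)
  refine ((B _).le_opNorm _).trans ?_
  have h := B.le_opNorm (EuclideanSpace.single i 1)
  simpa using h

end TensorApply

namespace IsRoughPath

variable {m : ℕ} {α : ℝ≥0} {a b : ℝ} {x : ℝ → EuclideanSpace ℝ (Fin m)}
  {X : ℝ → ℝ → Matrix (Fin m) (Fin m) ℝ}

lemma isOrder (hx : IsRoughPath α a b x X) : IsOrder a b α (fun s _ t ↦ x t - x s) :=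
  hx.holder.elim fun _ h ↦ .of_holderOnWith h

lemma isOrder_two (hx : IsRoughPath α a b x X) :
    IsOrder a b (2 * α) (fun s _ t ↦ ∑ i, ∑ j, |X s t i j|) := by
  obtain ⟨K, hK⟩ := hx.holder_two
  refine ⟨∑ _i : Fin m, ∑ _j : Fin m, K, fun s u t h1 h2 h3 h4 ↦ ?_⟩
  rw [Finset.sum_mul]
  refine norm_sum_le_of_le _ fun i _ ↦ ?_
  rw [Finset.sum_mul]
  refine norm_sum_le_of_le _ fun j _ ↦ ?_
  simpa using hK s t h1 (h2.trans h3) h4 i j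

lemma chen_eq (hx : IsRoughPath α a b x X) {s u t : ℝ} (hs : a ≤ s) (hsu : s ≤ u) (hut : u ≤ t)
    (ht : t ≤ b) :
    X s t - X s u - X u t = Matrix.vecMulVec (x u - x s).ofLp (x t - x u).ofLp := by
  ext i j
  simpa [Matrix.vecMulVec_apply] using hx.chen s u t hs hsu hut ht i j

lemma diag (hx : IsRoughPath α a b x X) {s : ℝ} (hs : a ≤ s) (hs' : s ≤ b) : X s s = 0 := by
  simpa [sub_self] using hx.chen_eq hs le_rfl le_rfl hs'

lemma continuousOn_path (hα : 0 < α) (hx : IsRoughPath α a b x X) : ContinuousOn x (Icc a b) :=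
  hx.holder.elim fun _ h ↦ h.continuousOn hα

/-- Chen's relation from the base point `a` expresses `X s t` through `X a t`, `X a s` and
increments of `x`. Joint continuity thus reduces to that of `X a ·`, which follows from Chen's
relation and the Hölder bounds. -/
lemma continuousOn_area (hα : 0 < α) (hx : IsRoughPath α a b x X) (i j : Fin m) :
    ContinuousOn (fun p : ℝ × ℝ ↦ X p.1 p.2 i j) {p | a ≤ p.1 ∧ p.1 ≤ p.2 ∧ p.2 ≤ b} := by
  have hα' : (0 : ℝ) < α := hα
  have hc := hx.continuousOn_path hα
  have base : ContinuousOn (fun t ↦ X a t i j) (Icc a b) := by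
    refine IsOrder.continuousOn hα' ?_
    have h1 : IsOrder a b α (fun s _ t ↦ X s t i j) := by
      refine (hx.isOrder_two.mono hα'.le (by linarith)).of_norm_le 1 fun s u t _ _ _ _ ↦ ?_
      rw [one_mul, Real.norm_eq_abs, Real.norm_eq_abs]
      refine le_trans ?_ (le_abs_self _)
      exact (Finset.single_le_sum (f := fun j ↦ |X s t i j|) (fun _ _ ↦ abs_nonneg _)
        (Finset.mem_univ j)).trans (Finset.single_le_sum (f := fun i ↦ ∑ j, |X s t i j|)
          (fun _ _ ↦ Finset.sum_nonneg fun _ _ ↦ abs_nonneg _) (Finset.mem_univ i))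
    have h2 : IsOrder a b (0 + α) (fun s _ t ↦ (x s i - x a i) * (x t j - x s j)) := by
      refine IsOrder.of_norm_le_mul (e₁ := fun s _ _ ↦ x s - x a)
        (IsOrder.of_continuousOn_left (hc.sub continuousOn_const)) hx.isOrder le_rfl hα'.le
        fun s u t _ _ _ _ ↦ ?_
      rw [norm_mul]
      exact mul_le_mul (PiLp.norm_apply_le (x s - x a) i) (PiLp.norm_apply_le (x t - x s) j)
        (norm_nonneg _) (norm_nonneg _)
    rw [zero_add] at h2
    refine (h1.add h2).congr fun s u t h1 h2 h3 h4 ↦ ?_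
    have := hx.chen a s t le_rfl h1 (h2.trans h3) h4 i j
    linarith
  have hfst : MapsTo Prod.fst {p : ℝ × ℝ | a ≤ p.1 ∧ p.1 ≤ p.2 ∧ p.2 ≤ b} (Icc a b) :=
    fun p hp ↦ ⟨hp.1, hp.2.1.trans hp.2.2⟩
  have hsnd : MapsTo Prod.snd {p : ℝ × ℝ | a ≤ p.1 ∧ p.1 ≤ p.2 ∧ p.2 ≤ b} (Icc a b) :=
    fun p hp ↦ ⟨hp.1.trans hp.2.1, hp.2.2⟩
  have hcoord : ∀ i, ContinuousOn (fun t ↦ x t i) (Icc a b) := fun i ↦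
    (EuclideanSpace.proj (𝕜 := ℝ) i).continuous.comp_continuousOn hc
  have h := ((base.comp continuousOn_snd hsnd).sub (base.comp continuousOn_fst hfst)).sub
    ((((hcoord i).comp continuousOn_fst hfst).sub (continuousOn_const (c := x a i))).mul
      (((hcoord j).comp continuousOn_snd hsnd).sub ((hcoord j).comp continuousOn_fst hfst)))
  refine h.congr fun p hp ↦ ?_
  have := hx.chen a p.1 p.2 le_rfl hp.1 hp.2.1 hp.2.2 i j
  simp only [Pi.sub_apply, Pi.mul_apply, Function.comp]
  linarith

end IsRoughPath

namespace IsControlled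

variable {m : ℕ} {α : ℝ≥0} {a b : ℝ} {x : ℝ → EuclideanSpace ℝ (Fin m)}
  {X : ℝ → ℝ → Matrix (Fin m) (Fin m) ℝ} {F G : Type*} [NormedAddCommGroup F] [NormedSpace ℝ F]
  [NormedAddCommGroup G] [NormedSpace ℝ G]

lemma isOrder_remainder {y : ℝ → F} {y' : ℝ → EuclideanSpace ℝ (Fin m) →L[ℝ] F}
    (h : IsControlled α a b x y y') :
    IsOrder a b (2 * α) (fun s _ t ↦ y t - y s - y' s (x t - x s)) :=
  h.remainder.elim fun K hK ↦ ⟨K, fun s _ t h1 h2 h3 h4 ↦ hK s t h1 (h2.trans h3) h4⟩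

lemma of_isOrder {y : ℝ → F} {y' : ℝ → EuclideanSpace ℝ (Fin m) →L[ℝ] F}
    (h₁ : IsOrder a b α (fun s _ t ↦ y t - y s)) (h₂ : IsOrder a b α (fun s _ t ↦ y' t - y' s))
    (h₃ : IsOrder a b (2 * α) (fun s _ t ↦ y t - y s - y' s (x t - x s))) :
    IsControlled α a b x y y' where
  holder := h₁.exists_holderOnWith
  holder_deriv := h₂.exists_holderOnWith
  remainder := h₃.elim fun K hK ↦ ⟨K, fun s t h1 h2 h3 ↦ hK s s t h1 le_rfl h2 h3⟩

lemma isOrder {y : ℝ → F} {y' : ℝ → EuclideanSpace ℝ (Fin m) →L[ℝ] F}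
    (h : IsControlled α a b x y y') : IsOrder a b α (fun s _ t ↦ y t - y s) :=
  h.holder.elim fun _ h ↦ .of_holderOnWith h

lemma isOrder_deriv {y : ℝ → F} {y' : ℝ → EuclideanSpace ℝ (Fin m) →L[ℝ] F}
    (h : IsControlled α a b x y y') : IsOrder a b α (fun s _ t ↦ y' t - y' s) :=
  h.holder_deriv.elim fun _ h ↦ .of_holderOnWith h

lemma clm_comp {y : ℝ → F} {y' : ℝ → EuclideanSpace ℝ (Fin m) →L[ℝ] F}
    (h : IsControlled α a b x y y') (L : F →L[ℝ] G) :
    IsControlled α a b x (fun t ↦ L (y t)) (fun t ↦ L ∘L y' t) := by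
  refine of_isOrder (h.isOrder.of_norm_le ‖L‖ fun s u t _ _ _ _ ↦ ?_)
    (h.isOrder_deriv.of_norm_le ‖L‖ fun s u t _ _ _ _ ↦ ?_)
    (h.isOrder_remainder.of_norm_le ‖L‖ fun s u t _ _ _ _ ↦ ?_)
  · rw [← map_sub]; exact L.le_opNorm _
  · rw [← ContinuousLinearMap.comp_sub]; exact L.opNorm_comp_le _
  · rw [ContinuousLinearMap.comp_apply, ← map_sub, ← map_sub]; exact L.le_opNorm _

/-- The germ of the rough integral is almost additive. -/
lemma isOrder_germ (hx : IsRoughPath α a b x X)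
    {z : ℝ → EuclideanSpace ℝ (Fin m) →L[ℝ] F}
    {z' : ℝ → EuclideanSpace ℝ (Fin m) →L[ℝ] EuclideanSpace ℝ (Fin m) →L[ℝ] F}
    (h : IsControlled α a b x z z') :
    IsOrder a b (3 * α) (fun s u t ↦ (z u (x t - x u) + tensorApply (z' u) (X u t))
      + (z s (x u - x s) + tensorApply (z' s) (X s u))
      - (z s (x t - x s) + tensorApply (z' s) (X s t))) := by
  have hα := α.coe_nonneg
  -- After Chen's relation the defect is the remainder of `z` applied to an increment of `x`, plus
  -- an increment of `z'` contracted with `X`; both have total order `3 α`.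
  have h1 : IsOrder a b (2 * α + α)
      (fun s u t ↦ (z u - z s - z' s (x u - x s)) (x t - x u)) :=
    IsOrder.of_norm_le_mul (h.isOrder_remainder.comp_left (by linarith))
      (hx.isOrder.comp_right hα) (by linarith) hα fun s u t _ _ _ _ ↦
        ContinuousLinearMap.le_opNorm _ _
  have h2 : IsOrder a b (α + 2 * α) (fun s u t ↦ tensorApply (z' u - z' s) (X u t)) :=
    IsOrder.of_norm_le_mul (h.isOrder_deriv.comp_left hα)
      (hx.isOrder_two.comp_right (e := fun s t ↦ ∑ i, ∑ j, |X s t i j|) (by linarith))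
      hα (by linarith) fun s u t _ _ _ _ ↦ norm_tensorApply_le _ _
  rw [show 2 * (α : ℝ) + α = 3 * α by ring] at h1
  rw [show (α : ℝ) + 2 * α = 3 * α by ring] at h2
  refine (h1.add h2).congr fun s u t hs hsu hut ht ↦ ?_
  have hc := congrArg (tensorApply (z' s)) (hx.chen_eq hs hsu hut ht)
  rw [tensorApply_sub, tensorApply_sub, tensorApply_vecMulVec] at hc
  rw [tensorApply_sub_left, sub_apply, sub_apply, ← hc,
    show x t - x s = (x t - x u) + (x u - x s) by abel, map_add]
  abel

end IsControlled

/-! ### The second order expansion of the linear flow -/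

section FlowGerm

variable {m d : ℕ} (C : Fin m → Matrix (Fin d) (Fin d) ℝ)

/-- The bilinear map `(v, w) ↦ (C · w) (C · v)`. -/
noncomputable def linearNoiseSq :
    EuclideanSpace ℝ (Fin m) →L[ℝ] EuclideanSpace ℝ (Fin m) →L[ℝ]
      (EuclideanSpace ℝ (Fin d) →L[ℝ] EuclideanSpace ℝ (Fin d)) :=
  (ContinuousLinearMap.compL ℝ (EuclideanSpace ℝ (Fin d)) (EuclideanSpace ℝ (Fin d))
    (EuclideanSpace ℝ (Fin d))).flip.bilinearComp (linearNoise C).flip (linearNoise C).flip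

/-- The earlier increment `v` acts first and so stands on the right, as in the product of the
expansions over `[s, u]` and `[u, t]`. -/
lemma linearNoiseSq_apply (v w : EuclideanSpace ℝ (Fin m)) :
    linearNoiseSq C v w = (linearNoise C).flip w * (linearNoise C).flip v := rfl

/-- The second order expansion of the flow of `dy = C y dx`. -/
noncomputable def flowGerm (x : ℝ → EuclideanSpace ℝ (Fin m))
    (X : ℝ → ℝ → Matrix (Fin m) (Fin m) ℝ) (s t : ℝ) :
    EuclideanSpace ℝ (Fin d) →L[ℝ] EuclideanSpace ℝ (Fin d) :=
  1 + (linearNoise C).flip (x t - x s) + tensorApply (linearNoiseSq C) (X s t)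

variable {C} {α : ℝ≥0} {a b : ℝ} {x : ℝ → EuclideanSpace ℝ (Fin m)}
  {X : ℝ → ℝ → Matrix (Fin m) (Fin m) ℝ}

lemma flowGerm_apply (s t : ℝ) (y : EuclideanSpace ℝ (Fin d)) :
    flowGerm C x X s t y = y + (linearNoise C y (x t - x s)
      + tensorApply (linearNoise C ∘L linearNoise C y) (X s t)) := by
  simp only [flowGerm, add_apply, ContinuousLinearMap.flip_apply, tensorApply, sum_apply,
    smul_apply, linearNoiseSq_apply, mul_apply_eq_comp, ContinuousLinearMap.comp_apply,
    one_apply_eq_self, add_assoc]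

lemma flowGerm_self (hx : IsRoughPath α a b x X) {s : ℝ} (hs : a ≤ s) (hs' : s ≤ b) :
    flowGerm C x X s s = 1 := by
  simp [flowGerm, hx.diag hs hs', tensorApply_zero]

lemma isOrder_tensorApply (hx : IsRoughPath α a b x X) {F : Type*} [NormedAddCommGroup F]
    [NormedSpace ℝ F]
    (B : EuclideanSpace ℝ (Fin m) →L[ℝ] EuclideanSpace ℝ (Fin m) →L[ℝ] F) :
    IsOrder a b (2 * α) (fun s _ t ↦ tensorApply B (X s t)) :=
  hx.isOrder_two.of_norm_le ‖B‖ fun _ _ _ _ _ _ _ ↦ norm_tensorApply_le _ _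

lemma isOrder_flowGerm_sub_one (hx : IsRoughPath α a b x X) :
    IsOrder a b α (fun s _ t ↦ flowGerm C x X s t - 1) := by
  have hα := α.coe_nonneg
  refine ((hx.isOrder.of_norm_le ‖(linearNoise C).flip‖ fun _ _ _ _ _ _ _ ↦
    ContinuousLinearMap.le_opNorm _ _).add ((isOrder_tensorApply hx (linearNoiseSq C)).mono hα
      (by linarith))).congr fun s _ t _ _ _ _ ↦ ?_
  rw [flowGerm]
  abel

/-- By Chen's relation, the expansion of the flow is almost multiplicative. -/
lemma isOrder_flowGerm_mul (hx : IsRoughPath α a b x X) :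
    IsOrder a b (3 * α) (fun s u t ↦
      flowGerm C x X u t * flowGerm C x X s u - flowGerm C x X s t) := by
  have hα := α.coe_nonneg
  have h1 : IsOrder a b α (fun s _ t ↦ (linearNoise C).flip (x t - x s)) :=
    hx.isOrder.of_norm_le ‖(linearNoise C).flip‖ fun _ _ _ _ _ _ _ ↦
      ContinuousLinearMap.le_opNorm _ _
  have h2 := isOrder_tensorApply hx (linearNoiseSq C)
  have h1l := h1.comp_left (e := fun s t ↦ (linearNoise C).flip (x t - x s)) hα
  have h1r := h1.comp_right (e := fun s t ↦ (linearNoise C).flip (x t - x s)) hα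
  have h2l := h2.comp_left (e := fun s t ↦ tensorApply (linearNoiseSq C) (X s t)) (by linarith)
  have h2r := h2.comp_right (e := fun s t ↦ tensorApply (linearNoiseSq C) (X s t)) (by linarith)
  -- Chen's relation absorbs the product of the two first order terms. The three products left have
  -- orders `3 α`, `3 α` and `4 α`.
  have e1 := (h1r.mul h2l hα (by linarith)).mono (q := 3 * α) (by linarith) (by linarith)
  have e2 := (h2r.mul h1l (by linarith) hα).mono (q := 3 * α) (by linarith) (by linarith)
  have e3 := (h2r.mul h2l (by linarith) (by linarith)).mono (q := 3 * α) (by linarith) (by linarith)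
  refine ((e1.add e2).add e3).congr fun s u t hs hsu hut ht ↦ ?_
  have hc := congrArg (tensorApply (linearNoiseSq C)) (hx.chen_eq hs hsu hut ht)
  rw [tensorApply_sub, tensorApply_sub, tensorApply_vecMulVec, linearNoiseSq_apply] at hc
  have hc' := sub_eq_iff_eq_add.1 (sub_eq_iff_eq_add.1 hc)
  simp only [flowGerm]
  rw [hc', show x t - x s = (x t - x u) + (x u - x s) by abel, map_add]
  simp only [mul_add, add_mul, mul_one, one_mul]
  abel

lemma continuousOn_flowGerm (hα : 0 < α) (hx : IsRoughPath α a b x X) :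
    ContinuousOn (fun p : ℝ × ℝ ↦ flowGerm C x X p.1 p.2)
      {p | a ≤ p.1 ∧ p.1 ≤ p.2 ∧ p.2 ≤ b} := by
  have hc := hx.continuousOn_path hα
  have h1 : ContinuousOn (fun p : ℝ × ℝ ↦ x p.1) {p | a ≤ p.1 ∧ p.1 ≤ p.2 ∧ p.2 ≤ b} :=
    hc.comp continuousOn_fst fun p hp ↦ ⟨hp.1, hp.2.1.trans hp.2.2⟩
  have h2 : ContinuousOn (fun p : ℝ × ℝ ↦ x p.2) {p | a ≤ p.1 ∧ p.1 ≤ p.2 ∧ p.2 ≤ b} :=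
    hc.comp continuousOn_snd fun p hp ↦ ⟨hp.1.trans hp.2.1, hp.2.2⟩
  have h3 := fun i j ↦ hx.continuousOn_area hα i j
  refine (continuousOn_const.add
    ((linearNoise C).flip.continuous.comp_continuousOn (h2.sub h1))).add ?_
  exact continuousOn_finsetSum _ fun i _ ↦ continuousOn_finsetSum _ fun j _ ↦
    (h3 i j).smul continuousOn_const

end FlowGerm

/-- The rough integral is a limit of sums over partitions. -/
lemma hasRoughIntegral_iff {m : ℕ} {F : Type*} [NormedAddCommGroup F] [NormedSpace ℝ F]
    {x : ℝ → EuclideanSpace ℝ (Fin m)} {X : ℝ → ℝ → Matrix (Fin m) (Fin m) ℝ}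
    {z : ℝ → EuclideanSpace ℝ (Fin m) →L[ℝ] F}
    {z' : ℝ → EuclideanSpace ℝ (Fin m) →L[ℝ] EuclideanSpace ℝ (Fin m) →L[ℝ] F} {s t : ℝ} {I : F} :
    HasRoughIntegral x X z z' s t I ↔
      HasPartitionLimit (fun u v ↦ z u (x v - x u) + tensorApply (z' u) (X u v)) s t I :=
  Iff.rfl

/-! ### Davie solutions and the integral equations -/

section Davie

variable {m d : ℕ} {α : ℝ≥0} {a b : ℝ} {x : ℝ → EuclideanSpace ℝ (Fin m)}
  {X : ℝ → ℝ → Matrix (Fin m) (Fin m) ℝ} {A : Matrix (Fin d) (Fin d) ℝ}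
  {f : EuclideanSpace ℝ (Fin d) → EuclideanSpace ℝ (Fin d)}
  {C : Fin m → Matrix (Fin d) (Fin d) ℝ}
  {y : ℝ → EuclideanSpace ℝ (Fin d)}
  {y' : ℝ → EuclideanSpace ℝ (Fin m) →L[ℝ] EuclideanSpace ℝ (Fin d)}

/-- Davie's notion of a solution of `dy = g(y) dt + C y dx`: a continuous path whose increments
agree with the second order expansion up to an error of order `3 α`. -/
structure IsDavieSolution (α : ℝ≥0) (a b : ℝ) (x : ℝ → EuclideanSpace ℝ (Fin m))
    (X : ℝ → ℝ → Matrix (Fin m) (Fin m) ℝ)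
    (g : EuclideanSpace ℝ (Fin d) → EuclideanSpace ℝ (Fin d))
    (C : Fin m → Matrix (Fin d) (Fin d) ℝ) (y : ℝ → EuclideanSpace ℝ (Fin d)) : Prop where
  continuousOn : ContinuousOn y (Icc a b)
  expansion : IsOrder a b (3 * α)
    (fun s _ t ↦ y t - flowGerm C x X s t (y s) - ∫ u in s..t, g (y u))

lemma ContinuousOn.intervalIntegrable_comp {F G : Type*} [NormedAddCommGroup F]
    [NormedAddCommGroup G] {g : F → G} (hg : Continuous g) {y : ℝ → F}
    (hy : ContinuousOn y (Icc a b)) {s t : ℝ} (hs : s ∈ Icc a b) (ht : t ∈ Icc a b) :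
    IntervalIntegrable (fun u ↦ g (y u)) volume s t :=
  ((hg.comp_continuousOn hy).mono (uIcc_subset_Icc hs ht)).intervalIntegrable

/-- The germ of the rough integral of `C y`, for a controlled path with `y' = C y`. -/
lemma germ_eq_flowGerm_sub {s t : ℝ} (hy' : y' s = linearNoise C (y s)) :
    linearNoise C (y s) (x t - x s) + tensorApply (linearNoise C ∘L y' s) (X s t)
      = flowGerm C x X s t (y s) - y s := by
  rw [flowGerm_apply, hy', add_sub_cancel_left]

/-- A controlled path with `y' = C y` whose increments are those of the drift plus the limits of
the Riemann sums is a solution in the sense of Davie. -/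
lemma IsControlled.isDavieSolution (hα : 1 / 3 < α) (hx : IsRoughPath α a b x X)
    (hy : IsControlled α a b x y y') (hy' : ∀ t ∈ Icc a b, y' t = linearNoise C (y t))
    {g : EuclideanSpace ℝ (Fin d) → EuclideanSpace ℝ (Fin d)}
    (h : ∀ s t, a ≤ s → s ≤ t → t ≤ b → HasPartitionLimit
      (fun u v ↦ linearNoise C (y u) (x v - x u) + tensorApply (linearNoise C ∘L y' u) (X u v)) s t
      (y t - y s - ∫ u in s..t, g (y u))) : IsDavieSolution α a b x X g C y := by
  have hα0 : 0 < α := lt_trans (by norm_num) hα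
  have h3 : 1 < 3 * (α : ℝ) := by
    have : (1 / 3 : ℝ) < α := by exact_mod_cast hα
    linarith
  refine ⟨IsOrder.continuousOn (p := α) (by exact_mod_cast hα0) hy.isOrder, ?_⟩
  obtain ⟨K, hK⟩ := (hy.clm_comp (linearNoise C)).isOrder_germ hx
  obtain ⟨K', hK'⟩ := exists_norm_partitionLimit_sub_le h3
    (Ξ := fun u v ↦ linearNoise C (y u) (x v - x u) + tensorApply (linearNoise C ∘L y' u) (X u v))
    (fun s hs hs' ↦ by simp [hx.diag hs hs', tensorApply_zero]) hK
  refine ⟨K', fun s u t hs hsu hut ht ↦ ?_⟩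
  have := hK' s t _ hs (hsu.trans hut) ht (h s t hs (hsu.trans hut) ht)
  rw [germ_eq_flowGerm_sub (hy' s ⟨hs, by linarith⟩)] at this
  convert this using 2
  beta_reduce
  abel

namespace IsDavieSolution

variable {g : EuclideanSpace ℝ (Fin d) → EuclideanSpace ℝ (Fin d)}

/-- Truncating the expansion after its zeroth or first order term gives the Hölder bound or the
remainder bound. The drift has order `1`, which is at least `2 α` because `α < 1 / 2`. -/
lemma isControlled (hα : 1 / 3 < α) (hα' : α < 1 / 2) (hx : IsRoughPath α a b x X)
    (hg : Continuous g) (hy : IsDavieSolution α a b x X g C y)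
    (hy' : ∀ t ∈ Icc a b, y' t = linearNoise C (y t)) : IsControlled α a b x y y' := by
  have hα1 : (1 / 3 : ℝ) < α := by exact_mod_cast hα
  have hα2 : (α : ℝ) < 1 / 2 := by
    have : (α : ℝ) < ((1 / 2 : ℝ≥0) : ℝ) := by exact_mod_cast hα'
    simpa using this
  have hd : IsOrder a b (0 + 1) (fun s _ t ↦ ∫ u in s..t, g (y u)) := by
    obtain ⟨D, hD⟩ :=
      isCompact_Icc.exists_bound_of_continuousOn (hg.comp_continuousOn hy.continuousOn)
    exact IsOrder.integral (e := fun _ u _ ↦ g (y u))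
      (IsOrder.of_bounded fun s u t h1 h2 h3 h4 ↦ hD u ⟨h1.trans h2, h3.trans h4⟩)
  have hys := IsOrder.of_continuousOn_left hy.continuousOn
  have h1 : IsOrder a b α (fun s _ t ↦ y t - y s) := by
    have hm : IsOrder a b (α + 0) (fun s _ t ↦ (flowGerm C x X s t - 1) (y s)) :=
      IsOrder.of_norm_le_mul (isOrder_flowGerm_sub_one hx) hys (by linarith) le_rfl
        fun s _ t _ _ _ _ ↦ ContinuousLinearMap.le_opNorm _ _
    rw [add_zero] at hm
    refine ((hm.add (hd.mono (by linarith) (by linarith))).add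
      (hy.expansion.mono (by linarith) (by linarith))).congr fun s u t _ _ _ _ ↦ ?_
    simp only [sub_apply, one_apply_eq_self]
    abel
  refine IsControlled.of_isOrder h1 ?_ ?_
  · refine h1.of_norm_le ‖linearNoise C‖ fun s u t h1 h2 h3 h4 ↦ ?_
    rw [hy' s ⟨h1, by linarith⟩, hy' t ⟨by linarith, h4⟩, ← map_sub]
    exact ContinuousLinearMap.le_opNorm _ _
  · have hm : IsOrder a b (2 * α + 0) (fun s _ t ↦ tensorApply (linearNoiseSq C) (X s t) (y s)) :=
      IsOrder.of_norm_le_mul (isOrder_tensorApply hx (linearNoiseSq C)) hys (by linarith) le_rfl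
        fun s _ t _ _ _ _ ↦ ContinuousLinearMap.le_opNorm _ _
    rw [add_zero] at hm
    refine ((hm.add (hd.mono (by linarith) (by linarith))).add
      (hy.expansion.mono (by linarith) (by linarith))).congr fun s u t h1 h2 h3 h4 ↦ ?_
    rw [hy' s ⟨h1, by linarith⟩]
    simp only [flowGerm, add_apply, ContinuousLinearMap.flip_apply, one_apply_eq_self]
    abel

/-- Once the drift is subtracted, the increments of the path match the Riemann summands up to order
`3 α > 1`, so the sums telescope in the limit. -/
lemma hasPartitionLimit (hα : 1 / 3 < α) (hg : Continuous g)
    (hy : IsDavieSolution α a b x X g C y) (hy' : ∀ t ∈ Icc a b, y' t = linearNoise C (y t))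
    {s t : ℝ} (hs : a ≤ s) (hst : s ≤ t) (ht : t ≤ b) : HasPartitionLimit
      (fun u v ↦ linearNoise C (y u) (x v - x u) + tensorApply (linearNoise C ∘L y' u) (X u v)) s t
      (y t - y s - ∫ u in s..t, g (y u)) := by
  have h3 : 1 < 3 * (α : ℝ) := by
    have : (1 / 3 : ℝ) < α := by exact_mod_cast hα
    linarith
  obtain ⟨K, hK⟩ := hy.expansion
  have hsI : s ∈ Icc a b := ⟨hs, hst.trans ht⟩
  have := hasPartitionLimit_of_norm_sub_le (w := fun t ↦ y t - ∫ u in s..t, g (y u))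
    (s := s) (t := t) (K := K) (Ξ := fun u v ↦
      linearNoise C (y u) (x v - x u) + tensorApply (linearNoise C ∘L y' u) (X u v)) h3
    fun u v hu huv hv ↦ by
      have huI : u ∈ Icc a b := ⟨hs.trans hu, huv.trans (hv.trans ht)⟩
      have hvI : v ∈ Icc a b := ⟨huI.1.trans huv, hv.trans ht⟩
      have e := intervalIntegral.integral_add_adjacent_intervals
        (ContinuousOn.intervalIntegrable_comp hg hy.continuousOn hsI huI)
        (ContinuousOn.intervalIntegrable_comp hg hy.continuousOn huI hvI)
      have := hK u u v huI.1 le_rfl huv hvI.2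
      rw [germ_eq_flowGerm_sub (hy' u huI), ← e]
      convert this using 2
      beta_reduce
      abel
  convert this using 1
  simp only [intervalIntegral.integral_same]
  abel

end IsDavieSolution

/-- The equation concerns intervals starting at `a`, Davie's condition all subintervals; subtracting
the equations at `s` and `t` bridges the two. -/
theorem isForwardSolution_iff (hα : 1 / 3 < α) (hα' : α < 1 / 2) (hx : IsRoughPath α a b x X)
    (hf : Continuous f) : IsForwardSolution α a b x X A f C y y' ↔
      (∀ t ∈ Icc a b, y' t = linearNoise C (y t)) ∧
        IsDavieSolution α a b x X (fun v ↦ Matrix.toEuclideanCLM (𝕜 := ℝ) A v + f v) C y := by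
  have hg : Continuous fun v ↦ Matrix.toEuclideanCLM (𝕜 := ℝ) A v + f v := by fun_prop
  constructor
  swap
  · rintro ⟨hy', hy⟩
    refine ⟨hy.isControlled hα hα' hx hg hy', hy', fun t ht ↦ ?_⟩
    refine ⟨_, hasRoughIntegral_iff.2 (hy.hasPartitionLimit hα hg hy' le_rfl ht.1 ht.2), ?_⟩
    beta_reduce
    abel
  intro h
  refine ⟨h.deriv_eq, h.controlled.isDavieSolution hα hx h.deriv_eq fun s t hs hst ht ↦ ?_⟩
  have hc : ContinuousOn y (Icc a b) :=
    h.controlled.holder.elim fun _ h ↦ h.continuousOn (lt_trans (by norm_num) hα)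
  have hsI : s ∈ Icc a b := ⟨hs, hst.trans ht⟩
  have htI : t ∈ Icc a b := ⟨hs.trans hst, ht⟩
  have haI : a ∈ Icc a b := ⟨le_rfl, by linarith [hsI.2]⟩
  obtain ⟨I, hI, eI⟩ := h.equation s hsI
  obtain ⟨J, hJ, eJ⟩ := h.equation t htI
  have e := intervalIntegral.integral_add_adjacent_intervals
    (ContinuousOn.intervalIntegrable_comp hg hc haI hsI)
    (ContinuousOn.intervalIntegrable_comp hg hc hsI htI)
  beta_reduce at e ⊢
  have key := (hasRoughIntegral_iff.1 hI).sub_left hs (hasRoughIntegral_iff.1 hJ)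
  rwa [show J - I = y t - y s - ∫ u in s..t, Matrix.toEuclideanCLM (𝕜 := ℝ) A (y u) + f (y u) by
    rw [eI, eJ, ← e]; abel] at key

/-- The right-hand side is the same as in the forward case, so the rough path never has to be
reversed in time. -/
theorem isBackwardSolution_iff (hα : 1 / 3 < α) (hα' : α < 1 / 2) (hx : IsRoughPath α a b x X)
    (hf : Continuous f) : IsBackwardSolution α a b x X A f C y y' ↔
      (∀ t ∈ Icc a b, y' t = linearNoise C (y t)) ∧
        IsDavieSolution α a b x X (fun v ↦ Matrix.toEuclideanCLM (𝕜 := ℝ) A v + f v) C y := by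
  have hg : Continuous fun v ↦ Matrix.toEuclideanCLM (𝕜 := ℝ) A v + f v := by fun_prop
  constructor
  swap
  · rintro ⟨hy', hy⟩
    refine ⟨hy.isControlled hα hα' hx hg hy', hy', fun t ht ↦ ?_⟩
    refine ⟨_, hasRoughIntegral_iff.2 (hy.hasPartitionLimit hα hg hy' ht.1 ht.2 le_rfl), ?_⟩
    beta_reduce
    abel
  intro h
  refine ⟨h.deriv_eq, h.controlled.isDavieSolution hα hx h.deriv_eq fun s t hs hst ht ↦ ?_⟩
  have hc : ContinuousOn y (Icc a b) :=
    h.controlled.holder.elim fun _ h ↦ h.continuousOn (lt_trans (by norm_num) hα)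
  have hsI : s ∈ Icc a b := ⟨hs, hst.trans ht⟩
  have htI : t ∈ Icc a b := ⟨hs.trans hst, ht⟩
  have hbI : b ∈ Icc a b := ⟨by linarith [hsI.1, hsI.2], le_rfl⟩
  obtain ⟨I, hI, eI⟩ := h.equation s hsI
  obtain ⟨J, hJ, eJ⟩ := h.equation t htI
  have e := intervalIntegral.integral_add_adjacent_intervals
    (ContinuousOn.intervalIntegrable_comp hg hc hsI htI)
    (ContinuousOn.intervalIntegrable_comp hg hc htI hbI)
  beta_reduce at e ⊢
  have key := (hasRoughIntegral_iff.1 hJ).sub_right ht (hasRoughIntegral_iff.1 hI)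
  rwa [show I - J = y t - y s - ∫ u in s..t, Matrix.toEuclideanCLM (𝕜 := ℝ) A (y u) + f (y u) by
    rw [eI, eJ, ← e]; abel] at key

end Davie

/-! ### The flow and the Doss-Sussmann transform -/

lemma hasDerivWithinAt_zero_of_isOrder {F : Type*} [NormedAddCommGroup F] [NormedSpace ℝ F]
    {a b p : ℝ} {w : ℝ → F} (hp : 1 < p) (hw : IsOrder a b p (fun s _ t ↦ w t - w s)) {t : ℝ}
    (ht : t ∈ Icc a b) : HasDerivWithinAt w 0 (Icc a b) t := by
  obtain ⟨K, hK0, hK⟩ := hw.exists_nonneg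
  have hsymm : ∀ s ∈ Icc a b, ‖w s - w t‖ ≤ K * |s - t| ^ (p - 1) * |s - t| := by
    intro s hs
    have e : |s - t| ^ p = |s - t| ^ (p - 1) * |s - t| := by
      have := Real.rpow_add_of_nonneg (abs_nonneg (s - t)) (show 0 ≤ p - 1 by linarith) zero_le_one
      rwa [Real.rpow_one, sub_add_cancel] at this
    rw [mul_assoc, ← e]
    rcases le_total s t with h | h
    · rw [norm_sub_rev, abs_sub_comm, abs_of_nonneg (sub_nonneg.2 h)]
      exact hK s s t hs.1 le_rfl h ht.2
    · rw [abs_of_nonneg (sub_nonneg.2 h)]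
      exact hK t t s ht.1 le_rfl h hs.2
  rw [hasDerivWithinAt_iff_isLittleO, Asymptotics.isLittleO_iff]
  intro c hc
  have hlim : Tendsto (fun s ↦ K * |s - t| ^ (p - 1)) (𝓝[Icc a b] t) (𝓝 0) := by
    have h1 : ContinuousAt (fun s ↦ K * |s - t| ^ (p - 1)) t :=
      continuousAt_const.mul (ContinuousAt.rpow_const (by fun_prop) (Or.inr (by linarith)))
    have := h1.tendsto
    rw [sub_self, abs_zero, Real.zero_rpow (by linarith), mul_zero] at this
    exact this.mono_left nhdsWithin_le_nhds
  filter_upwards [hlim.eventually (ge_mem_nhds hc), self_mem_nhdsWithin] with s hs hsI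
  rw [smul_zero, sub_zero, Real.norm_eq_abs]
  exact (hsymm s hsI).trans (mul_le_mul_of_nonneg_right hs (abs_nonneg _))

section Flow

variable {m d : ℕ} {α : ℝ≥0} {a b : ℝ} {x : ℝ → EuclideanSpace ℝ (Fin m)}
  {X : ℝ → ℝ → Matrix (Fin m) (Fin m) ℝ} {C : Fin m → Matrix (Fin d) (Fin d) ℝ}

/-- The flow of the linear rough differential equation `dy = C y dx`: an invertible path `φ` with
inverse `ψ`, such that `φ t * ψ s` agrees with the second order expansion up to an error of order
`3 α`. -/
theorem exists_flow (C : Fin m → Matrix (Fin d) (Fin d) ℝ) (hα : 1 / 3 < α)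
    (hx : IsRoughPath α a b x X) :
    ∃ φ ψ : ℝ → EuclideanSpace ℝ (Fin d) →L[ℝ] EuclideanSpace ℝ (Fin d),
      ContinuousOn φ (Icc a b) ∧ ContinuousOn ψ (Icc a b) ∧
      (∀ t ∈ Icc a b, φ t * ψ t = 1) ∧ (∀ t ∈ Icc a b, ψ t * φ t = 1) ∧
      IsOrder a b (3 * α) (fun s _ t ↦ φ t * ψ s - flowGerm C x X s t) := by
  have hα1 : (1 / 3 : ℝ) < α := by exact_mod_cast hα
  have hα0 : 0 < α := lt_trans (by norm_num) hα
  have : ProperSpace (EuclideanSpace ℝ (Fin d) →L[ℝ] EuclideanSpace ℝ (Fin d)) :=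
    FiniteDimensional.proper ℝ _
  obtain ⟨K₁, hK₁⟩ := isOrder_flowGerm_sub_one (C := C) hx
  obtain ⟨K₂, hK₂⟩ := isOrder_flowGerm_mul (C := C) hx
  obtain ⟨Φ, hmul, K₃, hK₃⟩ := exists_multiplicative_family (M := flowGerm C x X) (θ := 3 * α)
    (β := α) (a := a) (b := b) ContinuousLinearMap.norm_id_le (by linarith) (by linarith)
    (continuousOn_flowGerm hα0 hx) (fun s hs hs' ↦ flowGerm_self hx hs hs')
    (fun s t h1 h2 h3 ↦ hK₁ s s t h1 le_rfl h2 h3) hK₂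
  have hΦ : IsOrder a b (3 * α) (fun s _ t ↦ Φ s t - flowGerm C x X s t) :=
    ⟨K₃, fun s u t h1 h2 h3 h4 ↦ hK₃ s t h1 (h2.trans h3) h4⟩
  have hΦ1 : IsOrder a b α (fun s _ t ↦ Φ s t - 1) :=
    ((hΦ.mono (by linarith) (by linarith)).add (isOrder_flowGerm_sub_one hx)).congr
      fun s _ t _ _ _ _ ↦ by abel
  have hself : ∀ s ∈ Icc a b, Φ s s = 1 := by
    intro s hs
    have := hK₃ s s hs.1 le_rfl hs.2
    rw [sub_self, Real.zero_rpow (by linarith), mul_zero, flowGerm_self hx hs.1 hs.2] at this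
    exact sub_eq_zero.1 (norm_le_zero_iff.1 this)
  -- Multiplicativity gives `Φ a t - Φ a s = (Φ s t - 1) * Φ a s`, of order `α`.
  have hcont : ContinuousOn (fun t ↦ Φ a t) (Icc a b) := by
    obtain ⟨K, hK⟩ := hΦ1
    have hbd : IsOrder a b 0 (fun s _ _ ↦ Φ a s) := by
      refine IsOrder.of_bounded
        (C := ‖(1 : EuclideanSpace ℝ (Fin d) →L[ℝ] EuclideanSpace ℝ (Fin d))‖ + |K| * (b - a) ^ (α : ℝ)) fun s u t h1 h2 h3 h4 ↦ ?_
      refine (norm_le_norm_add_norm_sub' _ 1).trans (add_le_add le_rfl ?_)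
      refine (hK a a s le_rfl le_rfl h1 (by linarith)).trans (mul_le_mul (le_abs_self K) ?_
        (Real.rpow_nonneg (by linarith) _) (abs_nonneg K))
      exact Real.rpow_le_rpow (by linarith) (by linarith) α.coe_nonneg
    have := IsOrder.mul (𝔸 := EuclideanSpace ℝ (Fin d) →L[ℝ] EuclideanSpace ℝ (Fin d))
      ⟨K, hK⟩ hbd α.coe_nonneg le_rfl
    rw [add_zero] at this
    refine IsOrder.continuousOn (p := α) (by linarith) (this.congr fun s u t h1 h2 h3 h4 ↦ ?_)
    rw [sub_mul, one_mul, hmul a s t le_rfl h1 (h2.trans h3) h4]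
  -- Over short intervals `Φ` is within distance less than one of the identity, hence a unit by the
  -- Neumann series; finitely many such steps reach any `t`.
  have hunit : ∀ t ∈ Icc a b, IsUnit (Φ a t) := by
    obtain ⟨K, hK0, hK⟩ := hΦ1.exists_nonneg
    obtain ⟨δ, hδ0, hδ⟩ : ∃ δ : ℝ, 0 < δ ∧ K * δ ^ (α : ℝ) < 1 := by
      have ht : Tendsto (fun r : ℝ ↦ K * r ^ (α : ℝ)) (𝓝[>] 0) (𝓝 0) := by
        have h1 :=
          (Real.continuousAt_rpow_const 0 (α : ℝ) (Or.inr α.coe_nonneg)).tendsto.const_mul K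
        rw [Real.zero_rpow (by linarith), mul_zero] at h1
        exact h1.mono_left nhdsWithin_le_nhds
      obtain ⟨δ, h1, h2⟩ := ((ht.eventually (gt_mem_nhds one_pos)).and self_mem_nhdsWithin).exists
      exact ⟨δ, h2, h1⟩
    have near : ∀ s t, a ≤ s → s ≤ t → t ≤ b → t - s ≤ δ → IsUnit (Φ s t) := by
      intro s t hs hst ht hδst
      have h1 : ‖1 - Φ s t‖ < 1 := by
        rw [norm_sub_rev]
        refine ((hK s s t hs le_rfl hst ht).trans ?_).trans_lt hδ
        have : (t - s) ^ (α : ℝ) ≤ δ ^ (α : ℝ) :=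
          Real.rpow_le_rpow (by linarith) hδst α.coe_nonneg
        gcongr
      simpa using (Units.oneSub _ h1).isUnit
    have steps : ∀ n : ℕ, ∀ t ∈ Icc a b, t - a ≤ n * δ → IsUnit (Φ a t) := by
      intro n
      induction n with
      | zero =>
        intro t ht hn
        obtain rfl : t = a := le_antisymm (by simpa using hn) ht.1
        rw [hself t ht]
        exact isUnit_one
      | succ n ih =>
        intro t ht hn
        push_cast at hn
        have hs : a ≤ max a (t - δ) := le_max_left _ _
        have hst : max a (t - δ) ≤ t := max_le ht.1 (by linarith)
        rw [← hmul a (max a (t - δ)) t le_rfl hs hst ht.2]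
        refine (near _ t hs hst ht.2 ?_).mul (ih _ ⟨hs, hst.trans ht.2⟩ ?_)
        · have := le_max_right a (t - δ)
          linarith
        · have h0 : 0 ≤ n * δ := by positivity
          rw [sub_le_iff_le_add]
          exact max_le (by linarith) (by linarith)
    intro t ht
    obtain ⟨n, hn⟩ := exists_nat_ge ((t - a) / δ)
    exact steps n t ht (by rwa [div_le_iff₀ hδ0] at hn)
  have hψ : ContinuousOn (fun t ↦ Ring.inverse (Φ a t)) (Icc a b) := fun t ht ↦ by
    obtain ⟨u, hu⟩ := hunit t ht
    have := NormedRing.inverse_continuousAt u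
    rw [hu] at this
    exact this.comp_continuousWithinAt (hcont t ht)
  have hr : ∀ t ∈ Icc a b, Φ a t * Ring.inverse (Φ a t) = 1 := fun t ht ↦
    Ring.mul_inverse_cancel _ (hunit t ht)
  refine ⟨fun t ↦ Φ a t, fun t ↦ Ring.inverse (Φ a t), hcont, hψ, hr,
    fun t ht ↦ Ring.inverse_mul_cancel _ (hunit t ht), hΦ.congr fun s u t h1 h2 h3 h4 ↦ ?_⟩
  beta_reduce
  rw [← hmul a s t le_rfl h1 (h2.trans h3) h4, mul_assoc, hr s ⟨h1, by linarith⟩, mul_one]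

variable {φ ψ : ℝ → EuclideanSpace ℝ (Fin d) →L[ℝ] EuclideanSpace ℝ (Fin d)}
  {g : EuclideanSpace ℝ (Fin d) → EuclideanSpace ℝ (Fin d)}
  {y : ℝ → EuclideanSpace ℝ (Fin d)}

/-- The defect of `y` in the rough equation, and the defect of `ψ y` in the transformed ordinary
equation, agree up to the factor `φ` and an error of order `3 α`. -/
lemma isOrder_defect_sub (hα : 1 / 3 < α) (hα' : α < 1 / 2) (hx : IsRoughPath α a b x X)
    (hg : Continuous g) (hψ : ContinuousOn ψ (Icc a b))
    (hφψ : ∀ t ∈ Icc a b, φ t * ψ t = 1)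
    (hflow : IsOrder a b (3 * α) (fun s _ t ↦ φ t * ψ s - flowGerm C x X s t))
    (hy : ContinuousOn y (Icc a b)) :
    IsOrder a b (3 * α) (fun s _ t ↦
      φ t (ψ t (y t) - ψ s (y s) - ∫ u in s..t, ψ u (g (y u)))
        - (y t - flowGerm C x X s t (y s) - ∫ u in s..t, g (y u))) := by
  have hα1 : (1 / 3 : ℝ) < α := by exact_mod_cast hα
  have hα2 : (α : ℝ) < 1 / 2 := by
    have : (α : ℝ) < ((1 / 2 : ℝ≥0) : ℝ) := by exact_mod_cast hα'
    simpa using this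
  have hgy := hg.comp_continuousOn hy
  have h1 : IsOrder a b (3 * α + 0) (fun s _ t ↦ (φ t * ψ s - flowGerm C x X s t) (y s)) :=
    IsOrder.of_norm_le_mul hflow (IsOrder.of_continuousOn_left hy) (by linarith) le_rfl
      fun _ _ _ _ _ _ _ ↦ ContinuousLinearMap.le_opNorm _ _
  rw [add_zero] at h1
  have h2 : IsOrder a b α (fun s _ t ↦ φ t * ψ s - 1) :=
    ((hflow.mono (by linarith) (by linarith)).add (isOrder_flowGerm_sub_one hx)).congr
      fun s _ t _ _ _ _ ↦ by abel
  have h3 : IsOrder a b (α + 0) (fun _ u t ↦ (φ t * ψ u - 1) (g (y u))) := by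
    obtain ⟨D, hD⟩ := isCompact_Icc.exists_bound_of_continuousOn hgy
    exact IsOrder.of_norm_le_mul (e₂ := fun _ u _ ↦ g (y u))
      (h2.comp_right (e := fun s t ↦ φ t * ψ s - 1) (by linarith))
      (IsOrder.of_bounded fun s u t h1 h2 h3 h4 ↦ hD u ⟨h1.trans h2, h3.trans h4⟩) (by linarith)
      le_rfl fun _ _ _ _ _ _ _ ↦ ContinuousLinearMap.le_opNorm _ _
  rw [add_zero] at h3
  -- Integration raises the order `α` of `φ t * ψ u - 1` to `α + 1`, and `α + 1 ≥ 3 α` because `α <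
  -- 1 / 2`.
  refine ((h1.add (h3.integral.mono (q := 3 * α) (by linarith) (by linarith))).neg).congr
    fun s u t hs hsu hut ht ↦ ?_
  have hst : s ≤ t := hsu.trans hut
  have hsub : uIcc s t ⊆ Icc a b := by rw [uIcc_of_le hst]; exact Icc_subset_Icc hs ht
  have i1 : IntervalIntegrable (fun u ↦ ψ u (g (y u))) volume s t :=
    ((hψ.clm_apply hgy).mono hsub).intervalIntegrable
  have i2 : IntervalIntegrable (fun u ↦ g (y u)) volume s t := (hgy.mono hsub).intervalIntegrable
  have i1' : IntervalIntegrable (fun u ↦ φ t (ψ u (g (y u)))) volume s t :=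
    ((φ t).continuous.comp_continuousOn ((hψ.clm_apply hgy).mono hsub)).intervalIntegrable
  have e : ∫ u in s..t, (φ t * ψ u - 1) (g (y u))
      = φ t (∫ u in s..t, ψ u (g (y u))) - ∫ u in s..t, g (y u) := by
    rw [← ContinuousLinearMap.intervalIntegral_comp_comm _ i1, ← intervalIntegral.integral_sub
      i1' i2]
    rfl
  have e' : φ t (ψ t (y t)) = y t := by
    rw [← mul_apply_eq_comp, hφψ t ⟨by linarith, ht⟩, one_apply_eq_self]
  rw [e, map_sub, map_sub, e']
  simp only [sub_apply, mul_apply_eq_comp]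
  abel

/-- **Doss-Sussmann transform**: `y` solves the rough equation if and only if `ψ y` solves an
ordinary differential equation. -/
theorem isDavieSolution_iff_hasDerivWithinAt (hα : 1 / 3 < α) (hα' : α < 1 / 2)
    (hx : IsRoughPath α a b x X)
    (hg : Continuous g) (hψ : ContinuousOn ψ (Icc a b))
    (hφψ : ∀ t ∈ Icc a b, φ t * ψ t = 1) (hψφ : ∀ t ∈ Icc a b, ψ t * φ t = 1)
    (hflow : IsOrder a b (3 * α) (fun s _ t ↦ φ t * ψ s - flowGerm C x X s t))
    (hy : ContinuousOn y (Icc a b)) :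
    IsDavieSolution α a b x X g C y ↔
      ∀ t ∈ Icc a b, HasDerivWithinAt (fun t ↦ ψ t (y t)) (ψ t (g (y t))) (Icc a b) t := by
  have hα1 : (1 / 3 : ℝ) < α := by exact_mod_cast hα
  have hdef := isOrder_defect_sub hα hα' hx hg hψ hφψ hflow hy
  have hvc : ContinuousOn (fun u ↦ ψ u (g (y u))) (Icc a b) :=
    hψ.clm_apply (hg.comp_continuousOn hy)
  have hint : ∀ s ∈ Icc a b, ∀ t ∈ Icc a b,
      IntervalIntegrable (fun u ↦ ψ u (g (y u))) volume s t := fun s hs t ht ↦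
    (hvc.mono (uIcc_subset_Icc hs ht)).intervalIntegrable
  constructor
  · intro h t ht
    have haI : a ∈ Icc a b := ⟨le_rfl, ht.1.trans ht.2⟩
    have h1 : IsOrder a b (0 + 3 * α) (fun s _ t ↦
        ψ t (y t) - ψ s (y s) - ∫ u in s..t, ψ u (g (y u))) := by
      refine IsOrder.of_norm_le_mul (IsOrder.of_continuousOn_right hψ) (hdef.add h.expansion) le_rfl
        (by linarith) fun s u t h1 h2 h3 h4 ↦ ?_
      rw [sub_add_cancel]
      refine le_trans (le_of_eq ?_) (ContinuousLinearMap.le_opNorm _ _)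
      rw [← mul_apply_eq_comp, hψφ t ⟨by linarith, h4⟩, one_apply_eq_self]
    rw [zero_add] at h1
    -- Minus the integral of its expected derivative, `ψ y` has increments of order `3 α > 1`, hence
    -- derivative zero.
    have hw : IsOrder a b (3 * α) (fun s _ t ↦ (ψ t (y t) - ∫ u in a..t, ψ u (g (y u)))
        - (ψ s (y s) - ∫ u in a..s, ψ u (g (y u)))) := by
      refine h1.congr fun s u t h1 h2 h3 h4 ↦ ?_
      have hsI : s ∈ Icc a b := ⟨h1, by linarith⟩
      have htI : t ∈ Icc a b := ⟨by linarith, h4⟩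
      rw [← intervalIntegral.integral_add_adjacent_intervals (hint a haI s hsI) (hint s hsI t htI)]
      abel
    have d1 := hasDerivWithinAt_zero_of_isOrder
      (w := fun t ↦ ψ t (y t) - ∫ u in a..t, ψ u (g (y u))) (by linarith) hw ht
    have : Fact (t ∈ Icc a b) := ⟨ht⟩
    have d2 : HasDerivWithinAt (fun t ↦ ∫ u in a..t, ψ u (g (y u))) (ψ t (g (y t))) (Icc a b) t :=
      intervalIntegral.integral_hasDerivWithinAt_right (hint a haI t ht)
        (hvc.stronglyMeasurableAtFilter_nhdsWithin measurableSet_Icc t) (hvc t ht)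
    have d := d1.add d2
    rw [zero_add] at d
    exact d.congr (fun r _ ↦ (sub_add_cancel _ _).symm) (sub_add_cancel _ _).symm
  · intro h
    refine ⟨hy, hdef.neg.congr fun s u t h1 h2 h3 h4 ↦ ?_⟩
    have hst : s ≤ t := h2.trans h3
    have hsI : s ∈ Icc a b := ⟨h1, by linarith⟩
    have htI : t ∈ Icc a b := ⟨by linarith, h4⟩
    have hsub : Icc s t ⊆ Icc a b := Icc_subset_Icc h1 h4
    -- The integrated equation makes the transformed defect vanish, so the Davie defect is only the
    -- comparison error.
    have := intervalIntegral.integral_eq_sub_of_hasDerivAt_of_le hst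
      (f := fun t ↦ ψ t (y t)) (f' := fun u ↦ ψ u (g (y u)))
      ((hψ.clm_apply hy).mono hsub)
      (fun r hr ↦ (h r (hsub (Ioo_subset_Icc_self hr))).hasDerivAt
        (Icc_mem_nhds (h1.trans_lt hr.1) (hr.2.trans_le h4))) (hint s hsI t htI)
    rw [this, sub_self, map_zero, zero_sub, neg_neg]

end Flow

/-! ### Ordinary differential equations of linear growth -/

section ODE

variable {E : Type*} [NormedAddCommGroup E]

lemma exists_lipschitzOnWith_of_continuousOn {a b : ℝ} {G : ℝ → E → E}
    (hlip : ∀ R : ℝ, ∃ K : ℝ≥0, ∀ t ∈ Icc a b, LipschitzOnWith K (G t) (Metric.closedBall 0 R))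
    {v w : ℝ → E} (hv : ContinuousOn v (Icc a b)) (hw : ContinuousOn w (Icc a b)) :
    ∃ (R : ℝ) (K : ℝ≥0), (∀ t ∈ Icc a b, LipschitzOnWith K (G t) (Metric.closedBall 0 R)) ∧
      (∀ t ∈ Icc a b, v t ∈ Metric.closedBall 0 R) ∧
      ∀ t ∈ Icc a b, w t ∈ Metric.closedBall 0 R := by
  obtain ⟨R₁, h₁⟩ := isCompact_Icc.exists_bound_of_continuousOn hv
  obtain ⟨R₂, h₂⟩ := isCompact_Icc.exists_bound_of_continuousOn hw
  obtain ⟨K, hK⟩ := hlip (max R₁ R₂)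
  exact ⟨_, K, hK, fun t ht ↦ mem_closedBall_zero_iff.2 ((h₁ t ht).trans (le_max_left _ _)),
    fun t ht ↦ mem_closedBall_zero_iff.2 ((h₂ t ht).trans (le_max_right _ _))⟩

variable [NormedSpace ℝ E]

/-- The radial retraction onto the closed ball of radius `R` about `0`. -/
noncomputable def radialRetraction (R : ℝ) (v : E) : E := (R / max R ‖v‖) • v

lemma radialRetraction_of_norm_le {R : ℝ} (hR : 0 < R) {v : E} (hv : ‖v‖ ≤ R) :
    radialRetraction R v = v := by
  rw [radialRetraction, max_eq_left hv, div_self hR.ne', one_smul]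

lemma norm_radialRetraction {R : ℝ} (hR : 0 < R) (v : E) :
    ‖radialRetraction R v‖ = R / max R ‖v‖ * ‖v‖ := by
  have : 0 < max R ‖v‖ := lt_max_of_lt_left hR
  rw [radialRetraction, norm_smul, Real.norm_of_nonneg (by positivity)]

lemma norm_radialRetraction_le_radius {R : ℝ} (hR : 0 < R) (v : E) :
    ‖radialRetraction R v‖ ≤ R := by
  have : 0 < max R ‖v‖ := lt_max_of_lt_left hR
  rw [norm_radialRetraction hR, div_mul_eq_mul_div, div_le_iff₀ this]
  exact mul_le_mul_of_nonneg_left (le_max_right _ _) hR.le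

lemma norm_radialRetraction_le {R : ℝ} (hR : 0 < R) (v : E) : ‖radialRetraction R v‖ ≤ ‖v‖ := by
  have : 0 < max R ‖v‖ := lt_max_of_lt_left hR
  rw [norm_radialRetraction hR]
  exact mul_le_of_le_one_left (norm_nonneg v) ((div_le_one this).2 (le_max_left _ _))

/-- The difference splits into a change of vector and a change of scaling factor, each at most `‖v -
w‖`; hence the constant `2`, in any normed space. -/
lemma lipschitzWith_radialRetraction {R : ℝ} (hR : 0 < R) :
    LipschitzWith 2 (radialRetraction R : E → E) := by
  refine LipschitzWith.of_dist_le_mul fun v w ↦ ?_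
  rw [dist_eq_norm, dist_eq_norm]
  have hv : 0 < max R ‖v‖ := lt_max_of_lt_left hR
  have hw : 0 < max R ‖w‖ := lt_max_of_lt_left hR
  have e : radialRetraction R v - radialRetraction R w
      = (R / max R ‖v‖) • (v - w) + (R / max R ‖v‖ - R / max R ‖w‖) • w := by
    simp only [radialRetraction, smul_sub, sub_smul]
    abel
  have h1 : ‖(R / max R ‖v‖) • (v - w)‖ ≤ ‖v - w‖ := by
    rw [norm_smul, Real.norm_of_nonneg (by positivity)]
    exact mul_le_of_le_one_left (norm_nonneg _) ((div_le_one hv).2 (le_max_left _ _))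
  have h2 : ‖(R / max R ‖v‖ - R / max R ‖w‖) • w‖ ≤ ‖v - w‖ := by
    have e2 : R / max R ‖v‖ - R / max R ‖w‖
        = R / max R ‖v‖ * ((max R ‖w‖ - max R ‖v‖) / max R ‖w‖) := by field_simp
    have h3 : |max R ‖w‖ - max R ‖v‖| ≤ ‖v - w‖ := by
      have := abs_max_sub_max_le_max R ‖w‖ R ‖v‖
      rw [sub_self, abs_zero, max_eq_right (abs_nonneg (‖w‖ - ‖v‖))] at this
      rw [norm_sub_rev]
      exact this.trans (abs_norm_sub_norm_le w v)
    rw [norm_smul, e2, Real.norm_eq_abs, abs_mul,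
      abs_of_nonneg (by positivity : 0 ≤ R / max R ‖v‖), abs_div, abs_of_pos hw]
    have h4 : R / max R ‖v‖ ≤ 1 := (div_le_one hv).2 (le_max_left _ _)
    have h5 : |max R ‖w‖ - max R ‖v‖| / max R ‖w‖ * ‖w‖ ≤ ‖v - w‖ := by
      rw [div_mul_eq_mul_div, div_le_iff₀ hw]
      exact mul_le_mul h3 (le_max_right _ _) (norm_nonneg _) (norm_nonneg _)
    rw [mul_assoc]
    exact (mul_le_of_le_one_left (by positivity) h4).trans h5
  rw [e]
  refine (norm_add_le _ _).trans ?_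
  push_cast
  linarith

variable {a b N : ℝ} {G : ℝ → E → E}

/-- Global existence for ordinary differential equations with a locally Lipschitz right-hand side
of linear growth, forward in time. -/
theorem exists_ode_solution_of_linear_growth [CompleteSpace E] (hab : a ≤ b)
    (hlip : ∀ R : ℝ, ∃ K : ℝ≥0, ∀ t ∈ Icc a b, LipschitzOnWith K (G t) (Metric.closedBall 0 R))
    (hcont : ∀ v, ContinuousOn (fun t ↦ G t v) (Icc a b))
    (hN : ∀ t ∈ Icc a b, ∀ v, ‖G t v‖ ≤ N * (1 + ‖v‖)) (v₀ : E) :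
    ∃ v : ℝ → E, v a = v₀ ∧ ∀ t ∈ Icc a b, HasDerivWithinAt v (G t (v t)) (Icc a b) t := by
  have haI : a ∈ Icc a b := ⟨le_rfl, hab⟩
  have hN0 : 0 ≤ N := by
    have := (norm_nonneg _).trans (hN a haI 0)
    simpa using this
  -- The a priori Grönwall bound, increased by one to be positive.
  obtain ⟨R, hR⟩ : ∃ R : ℝ, R = |gronwallBound ‖v₀‖ N N (b - a)| + 1 := ⟨_, rfl⟩
  have hR0 : 0 < R := by rw [hR]; positivity
  have hRle : gronwallBound ‖v₀‖ N N (b - a) ≤ R := by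
    rw [hR]
    exact (le_abs_self _).trans (by linarith)
  obtain ⟨K, hK⟩ := hlip R
  have hL0 : 0 ≤ N * (1 + R) := by positivity
  have hmem : ∀ v : E, radialRetraction R v ∈ Metric.closedBall (0 : E) R := fun v ↦
    mem_closedBall_zero_iff.2 (norm_radialRetraction_le_radius hR0 v)
  -- Composed with the retraction, the field is globally Lipschitz and bounded, so Picard-Lindelöf
  -- covers the whole interval at once.
  have pl : IsPicardLindelof (fun t v ↦ G t (radialRetraction R v)) (tmin := a) (tmax := b)
      ⟨a, haI⟩ v₀ (N * (1 + R) * (b - a)).toNNReal 0 (N * (1 + R)).toNNReal (K * 2) := by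
    refine ⟨fun t ht ↦ ?_, fun v _ ↦ hcont _, fun t ht v _ ↦ ?_, ?_⟩
    · exact (hK t ht).comp (lipschitzWith_radialRetraction hR0).lipschitzOnWith
        fun v _ ↦ hmem v
    · rw [Real.coe_toNNReal _ hL0]
      refine (hN t ht _).trans ?_
      have := norm_radialRetraction_le_radius hR0 v
      gcongr
    · rw [Real.coe_toNNReal _ hL0, Real.coe_toNNReal _ (mul_nonneg hL0 (sub_nonneg.2 hab)),
        sub_self, max_eq_left (sub_nonneg.2 hab)]
      simp
  obtain ⟨v, hv0, hv⟩ := pl.exists_eq_forall_mem_Icc_hasDerivWithinAt₀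
  -- The retraction does not increase norms, so the truncated field obeys the same growth bound. Its
  -- solution stays in the ball of radius `R`, where the truncation does nothing.
  have hvR : ∀ t ∈ Icc a b, ‖v t‖ ≤ R := by
    intro t ht
    have := norm_le_gronwallBound_of_norm_deriv_right_le (f := v)
      (f' := fun t ↦ G t (radialRetraction R (v t))) (δ := ‖v₀‖) (K := N) (ε := N) (a := a) (b := b)
      (fun t ht ↦ (hv t ht).continuousWithinAt)
      (fun t ht ↦ (hv t (Ico_subset_Icc_self ht)).mono_of_mem_nhdsWithin
        (Icc_mem_nhdsGE_of_mem ht)) (le_of_eq (congrArg _ hv0))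
      (fun t ht ↦ by
        refine (hN t (Ico_subset_Icc_self ht) _).trans ?_
        have := norm_radialRetraction_le hR0 (v t)
        nlinarith) t ht
    exact (this.trans (gronwallBound_mono (norm_nonneg _) hN0 hN0 (by linarith [ht.2]))).trans hRle
  refine ⟨v, hv0, fun t ht ↦ ?_⟩
  have := hv t ht
  rwa [radialRetraction_of_norm_le hR0 (hvR t ht)] at this

/-- Global existence backward in time. -/
theorem exists_ode_solution_of_linear_growth_left [CompleteSpace E] (hab : a ≤ b)
    (hlip : ∀ R : ℝ, ∃ K : ℝ≥0, ∀ t ∈ Icc a b, LipschitzOnWith K (G t) (Metric.closedBall 0 R))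
    (hcont : ∀ v, ContinuousOn (fun t ↦ G t v) (Icc a b))
    (hN : ∀ t ∈ Icc a b, ∀ v, ‖G t v‖ ≤ N * (1 + ‖v‖)) (v₀ : E) :
    ∃ v : ℝ → E, v b = v₀ ∧ ∀ t ∈ Icc a b, HasDerivWithinAt v (G t (v t)) (Icc a b) t := by
  have hneg : ∀ t ∈ Icc (-b) (-a), -t ∈ Icc a b := fun t ht ↦
    ⟨by linarith [ht.2], by linarith [ht.1]⟩
  have hneg' : ∀ t ∈ Icc a b, -t ∈ Icc (-b) (-a) := fun t ht ↦
    ⟨by linarith [ht.2], by linarith [ht.1]⟩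
  obtain ⟨w, hw0, hw⟩ := exists_ode_solution_of_linear_growth (a := -b) (b := -a)
    (G := fun t v ↦ -G (-t) v) (N := N) (by linarith)
    (fun R ↦ (hlip R).imp fun K hK t ht ↦ (hK (-t) (hneg t ht)).neg)
    (fun v ↦ ((hcont v).comp continuousOn_neg hneg).neg)
    (fun t ht v ↦ by rw [norm_neg]; exact hN (-t) (hneg t ht) v) v₀
  refine ⟨fun t ↦ w (-t), hw0, fun t ht ↦ ?_⟩
  have h := (hw (-t) (hneg' t ht)).scomp t (hasDerivAt_neg t).hasDerivWithinAt hneg'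
  simp only [neg_neg, smul_neg, neg_smul, one_smul] at h
  exact h

theorem ode_solution_unique_right
    (hlip : ∀ R : ℝ, ∃ K : ℝ≥0, ∀ t ∈ Icc a b, LipschitzOnWith K (G t) (Metric.closedBall 0 R))
    {v w : ℝ → E} (hv : ∀ t ∈ Icc a b, HasDerivWithinAt v (G t (v t)) (Icc a b) t)
    (hw : ∀ t ∈ Icc a b, HasDerivWithinAt w (G t (w t)) (Icc a b) t) (h : v a = w a) :
    EqOn v w (Icc a b) := by
  have hvc : ContinuousOn v (Icc a b) := fun t ht ↦ (hv t ht).continuousWithinAt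
  have hwc : ContinuousOn w (Icc a b) := fun t ht ↦ (hw t ht).continuousWithinAt
  obtain ⟨R, K, hK, hvR, hwR⟩ := exists_lipschitzOnWith_of_continuousOn hlip hvc hwc
  have sub : ∀ t ∈ Ico a b, t ∈ Icc a b := fun t ht ↦ Ico_subset_Icc_self ht
  exact ODE_solution_unique_of_mem_Icc_right (s := fun _ ↦ Metric.closedBall 0 R)
    (fun t ht ↦ hK t (sub t ht)) hvc
    (fun t ht ↦ (hv t (sub t ht)).mono_of_mem_nhdsWithin (Icc_mem_nhdsGE_of_mem ht))
    (fun t ht ↦ hvR t (sub t ht)) hwc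
    (fun t ht ↦ (hw t (sub t ht)).mono_of_mem_nhdsWithin (Icc_mem_nhdsGE_of_mem ht))
    (fun t ht ↦ hwR t (sub t ht)) h

theorem ode_solution_unique_left
    (hlip : ∀ R : ℝ, ∃ K : ℝ≥0, ∀ t ∈ Icc a b, LipschitzOnWith K (G t) (Metric.closedBall 0 R))
    {v w : ℝ → E} (hv : ∀ t ∈ Icc a b, HasDerivWithinAt v (G t (v t)) (Icc a b) t)
    (hw : ∀ t ∈ Icc a b, HasDerivWithinAt w (G t (w t)) (Icc a b) t) (h : v b = w b) :
    EqOn v w (Icc a b) := by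
  have hvc : ContinuousOn v (Icc a b) := fun t ht ↦ (hv t ht).continuousWithinAt
  have hwc : ContinuousOn w (Icc a b) := fun t ht ↦ (hw t ht).continuousWithinAt
  obtain ⟨R, K, hK, hvR, hwR⟩ := exists_lipschitzOnWith_of_continuousOn hlip hvc hwc
  have sub : ∀ t ∈ Ioc a b, t ∈ Icc a b := fun t ht ↦ Ioc_subset_Icc_self ht
  exact ODE_solution_unique_of_mem_Icc_left (s := fun _ ↦ Metric.closedBall 0 R)
    (fun t ht ↦ hK t (sub t ht)) hvc
    (fun t ht ↦ (hv t (sub t ht)).mono_of_mem_nhdsWithin (Icc_mem_nhdsLE_of_mem ht))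
    (fun t ht ↦ hvR t (sub t ht)) hwc
    (fun t ht ↦ (hw t (sub t ht)).mono_of_mem_nhdsWithin (Icc_mem_nhdsLE_of_mem ht))
    (fun t ht ↦ hwR t (sub t ht)) h

end ODE

/-! ### Existence and uniqueness -/

section Main

variable {m d : ℕ} {α : ℝ≥0} {a b : ℝ} {x : ℝ → EuclideanSpace ℝ (Fin m)}
  {X : ℝ → ℝ → Matrix (Fin m) (Fin m) ℝ}
  {g : EuclideanSpace ℝ (Fin d) → EuclideanSpace ℝ (Fin d)}

/-- Existence and uniqueness of Davie solutions with a given value at either end point. -/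
theorem exists_unique_isDavieSolution (C : Fin m → Matrix (Fin d) (Fin d) ℝ) (hα : 1 / 3 < α)
    (hα' : α < 1 / 2) (hab : a ≤ b) (hx : IsRoughPath α a b x X) (hg : LocallyLipschitz g)
    (hg_growth : ∃ K : ℝ, ∀ v, ‖g v‖ ≤ K * (1 + ‖v‖)) (η : EuclideanSpace ℝ (Fin d)) :
    (∃ y, (IsDavieSolution α a b x X g C y ∧ y a = η) ∧
      ∀ z, IsDavieSolution α a b x X g C z → z a = η → EqOn z y (Icc a b)) ∧
    (∃ y, (IsDavieSolution α a b x X g C y ∧ y b = η) ∧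
      ∀ z, IsDavieSolution α a b x X g C z → z b = η → EqOn z y (Icc a b)) := by
  obtain ⟨φ, ψ, hφ, hψ, hφψ, hψφ, hflow⟩ := exists_flow C hα hx
  have hgc := hg.continuous
  have haI : a ∈ Icc a b := ⟨le_rfl, hab⟩
  have hbI : b ∈ Icc a b := ⟨hab, le_rfl⟩
  have hφψ' : ∀ t ∈ Icc a b, ∀ v, φ t (ψ t v) = v := fun t ht v ↦ by
    rw [← mul_apply_eq_comp, hφψ t ht, one_apply_eq_self]
  have hψφ' : ∀ t ∈ Icc a b, ∀ v, ψ t (φ t v) = v := fun t ht v ↦ by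
    rw [← mul_apply_eq_comp, hψφ t ht, one_apply_eq_self]
  obtain ⟨P, hP⟩ := isCompact_Icc.exists_bound_of_continuousOn hφ
  obtain ⟨Q, hQ⟩ := isCompact_Icc.exists_bound_of_continuousOn hψ
  obtain ⟨N, hN⟩ := hg_growth
  have hP0 : 0 ≤ P := (norm_nonneg _).trans (hP a haI)
  have hQ0 : 0 ≤ Q := (norm_nonneg _).trans (hQ a haI)
  have hN0 : 0 ≤ N := by simpa using (norm_nonneg _).trans (hN 0)
  have hφle : ∀ t ∈ Icc a b, ∀ v, ‖φ t v‖ ≤ P * ‖v‖ := fun t ht v ↦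
    (φ t).le_of_opNorm_le (hP t ht) v
  have hψle : ∀ t ∈ Icc a b, ∀ v, ‖ψ t v‖ ≤ Q * ‖v‖ := fun t ht v ↦
    (ψ t).le_of_opNorm_le (hQ t ht) v
  -- The field of the ordinary equation for `v = ψ y`; its Lipschitz and growth constants come from
  -- the bounds `P` and `Q` on `φ` and `ψ`.
  let G : ℝ → EuclideanSpace ℝ (Fin d) → EuclideanSpace ℝ (Fin d) := fun t v ↦ ψ t (g (φ t v))
  have hlip : ∀ R : ℝ, ∃ K : ℝ≥0, ∀ t ∈ Icc a b,
      LipschitzOnWith K (G t) (Metric.closedBall 0 R) := by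
    intro R
    obtain ⟨L, hL⟩ := (hg.locallyLipschitzOn (s := Metric.closedBall 0 (P * R))
      ).exists_lipschitzOnWith_of_compact (isCompact_closedBall _ _)
    refine ⟨Q.toNNReal * (L * P.toNNReal), fun t ht ↦ ?_⟩
    have l1 : LipschitzWith P.toNNReal (φ t) := (φ t).lipschitz.weaken
      (by rw [← norm_toNNReal]; exact Real.toNNReal_le_toNNReal (hP t ht))
    have l2 : LipschitzWith Q.toNNReal (ψ t) := (ψ t).lipschitz.weaken
      (by rw [← norm_toNNReal]; exact Real.toNNReal_le_toNNReal (hQ t ht))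
    refine (l2.lipschitzOnWith (s := univ)).comp (hL.comp l1.lipschitzOnWith fun v hv ↦ ?_)
      (mapsTo_univ _ _)
    rw [mem_closedBall_zero_iff] at hv ⊢
    exact (hφle t ht v).trans (by gcongr)
  have hcont : ∀ v, ContinuousOn (fun t ↦ G t v) (Icc a b) := fun v ↦
    hψ.clm_apply (hgc.comp_continuousOn (hφ.clm_apply continuousOn_const))
  have hgrow : ∀ t ∈ Icc a b, ∀ v, ‖G t v‖ ≤ Q * N * (1 + P) * (1 + ‖v‖) := by
    intro t ht v
    have h1 : ‖g (φ t v)‖ ≤ N * (1 + P * ‖v‖) := (hN _).trans (by gcongr; exact hφle t ht v)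
    have h2 : 1 + P * ‖v‖ ≤ (1 + P) * (1 + ‖v‖) := by nlinarith [norm_nonneg v]
    calc ‖G t v‖ ≤ Q * ‖g (φ t v)‖ := hψle t ht _
      _ ≤ Q * (N * ((1 + P) * (1 + ‖v‖))) := by gcongr; exact h1.trans (by gcongr)
      _ = _ := by ring
  have hsol : ∀ v : ℝ → EuclideanSpace ℝ (Fin d),
      (∀ t ∈ Icc a b, HasDerivWithinAt v (G t (v t)) (Icc a b) t) →
      IsDavieSolution α a b x X g C (fun t ↦ φ t (v t)) := by
    intro v hv
    have hvc : ContinuousOn v (Icc a b) := fun t ht ↦ (hv t ht).continuousWithinAt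
    refine (isDavieSolution_iff_hasDerivWithinAt hα hα' hx hgc hψ hφψ hψφ hflow
      (hφ.clm_apply hvc)).2 fun t ht ↦ ?_
    exact (hv t ht).congr (fun s hs ↦ hψφ' s hs _) (hψφ' t ht _)
  have hsol' : ∀ y, IsDavieSolution α a b x X g C y → ∀ t ∈ Icc a b,
      HasDerivWithinAt (fun t ↦ ψ t (y t)) (G t (ψ t (y t))) (Icc a b) t := by
    intro y hy t ht
    have := (isDavieSolution_iff_hasDerivWithinAt hα hα' hx hgc hψ hφψ hψφ hflow
      hy.continuousOn).1 hy t ht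
    simpa only [G, hφψ' t ht] using this
  have huniq : ∀ y z : ℝ → EuclideanSpace ℝ (Fin d),
      EqOn (fun t ↦ ψ t (z t)) (fun t ↦ ψ t (y t)) (Icc a b) → EqOn z y (Icc a b) := by
    intro y z h t ht
    rw [← hφψ' t ht (z t), ← hφψ' t ht (y t)]
    exact congrArg (φ t) (h ht)
  refine ⟨?_, ?_⟩
  · obtain ⟨v, hv0, hv⟩ := exists_ode_solution_of_linear_growth hab hlip hcont hgrow (ψ a η)
    have hya : φ a (v a) = η := by rw [hv0, hφψ' a haI]
    exact ⟨_, ⟨hsol v hv, hya⟩, fun z hz hza ↦ huniq _ _ (ode_solution_unique_right hlip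
      (hsol' z hz) (hsol' _ (hsol v hv)) (by beta_reduce; rw [hza, hya]))⟩
  · obtain ⟨v, hv0, hv⟩ := exists_ode_solution_of_linear_growth_left hab hlip hcont hgrow (ψ b η)
    have hyb : φ b (v b) = η := by rw [hv0, hφψ' b hbI]
    exact ⟨_, ⟨hsol v hv, hyb⟩, fun z hz hzb ↦ huniq _ _ (ode_solution_unique_left hlip
      (hsol' z hz) (hsol' _ (hsol v hv)) (by beta_reduce; rw [hzb, hyb]))⟩

end Main

theorem mainTheorem6 {m d : ℕ} {α : ℝ≥0} (hα : 1 / 3 < α) (hα' : α < 1 / 2)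
    (A : Matrix (Fin d) (Fin d) ℝ)
    (f : EuclideanSpace ℝ (Fin d) → EuclideanSpace ℝ (Fin d))
    (hf : LocallyLipschitz f) (hf_growth : ∃ K : ℝ, ∀ v, ‖f v‖ ≤ K * (1 + ‖v‖))
    (C : Fin m → Matrix (Fin d) (Fin d) ℝ)
    {a b : ℝ} (hab : a ≤ b)
    (x : ℝ → EuclideanSpace ℝ (Fin m)) (X : ℝ → ℝ → Matrix (Fin m) (Fin m) ℝ)
    (hx : IsRoughPath α a b x X) (η : EuclideanSpace ℝ (Fin d)) :
    (∃ (y : ℝ → EuclideanSpace ℝ (Fin d))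
        (y' : ℝ → EuclideanSpace ℝ (Fin m) →L[ℝ] EuclideanSpace ℝ (Fin d)),
      (IsForwardSolution α a b x X A f C y y' ∧ y a = η) ∧
      ∀ z z', IsForwardSolution α a b x X A f C z z' → z a = η →
        Set.EqOn z y (Set.Icc a b) ∧ Set.EqOn z' y' (Set.Icc a b)) ∧
    (∃ (y : ℝ → EuclideanSpace ℝ (Fin d))
        (y' : ℝ → EuclideanSpace ℝ (Fin m) →L[ℝ] EuclideanSpace ℝ (Fin d)),
      (IsBackwardSolution α a b x X A f C y y' ∧ y b = η) ∧
      ∀ z z', IsBackwardSolution α a b x X A f C z z' → z b = η →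
        Set.EqOn z y (Set.Icc a b) ∧ Set.EqOn z' y' (Set.Icc a b)) := by
  have hg : LocallyLipschitz fun v ↦ Matrix.toEuclideanCLM (𝕜 := ℝ) A v + f v :=
    (Matrix.toEuclideanCLM (𝕜 := ℝ) A).lipschitz.locallyLipschitz.add hf
  have hg_growth : ∃ K : ℝ, ∀ v, ‖Matrix.toEuclideanCLM (𝕜 := ℝ) A v + f v‖ ≤ K * (1 + ‖v‖) := by
    obtain ⟨K, hK⟩ := hf_growth
    refine ⟨‖Matrix.toEuclideanCLM (𝕜 := ℝ) A‖ + K, fun v ↦ (norm_add_le _ _).trans ?_⟩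
    have h1 := (Matrix.toEuclideanCLM (𝕜 := ℝ) A).le_opNorm v
    have h2 := norm_nonneg (Matrix.toEuclideanCLM (𝕜 := ℝ) A)
    linarith [hK v]
  have hfc := hf.continuous
  obtain ⟨⟨y, ⟨hy, hya⟩, hyu⟩, ⟨w, ⟨hw, hwb⟩, hwu⟩⟩ :=
    exists_unique_isDavieSolution C hα hα' hab hx hg hg_growth η
  refine ⟨⟨y, fun t ↦ linearNoise C (y t),
    ⟨(isForwardSolution_iff hα hα' hx hfc).2 ⟨fun _ _ ↦ rfl, hy⟩, hya⟩, fun z z' hz hza ↦ ?_⟩,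
    ⟨w, fun t ↦ linearNoise C (w t),
    ⟨(isBackwardSolution_iff hα hα' hx hfc).2 ⟨fun _ _ ↦ rfl, hw⟩, hwb⟩, fun z z' hz hzb ↦ ?_⟩⟩
  · obtain ⟨hz', hzd⟩ := (isForwardSolution_iff hα hα' hx hfc).1 hz
    have h := hyu z hzd hza
    exact ⟨h, fun t ht ↦ by rw [hz' t ht, h ht]⟩
  · obtain ⟨hz', hzd⟩ := (isBackwardSolution_iff hα hα' hx hfc).1 hz
    have h := hwu z hzd hzb
    exact ⟨h, fun t ht ↦ by rw [hz' t ht, h ht]⟩
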